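/- Let $\mathcal H$ be a complex separable Hilbert space, let $\mathcal B_1(\mathcal H)$ be the space of trace class operators on $\mathcal H$ with the trace norm $\|X\|_1=\mathrm{Tr}\,|X|$, and let $\mathcal H\otimes\mathcal H$ be the Hilbert space tensor product. A linear map $\Phi$ on $\mathcal B_1(\mathcal H)$ is called completely positive if for every $n$ it maps, entrywise, every $n\times n$ matrix over $\mathcal B_1(\mathcal H)$ that is a positive operator on $\mathcal H^{\oplus n}$ to such a matrix. A dynamical map is a family $\{\Lambda_t\}_{t\ge 0}$ of completely positive, trace preserving linear maps $\mathcal B_1(\mathcal H)\to\mathcal B_1(\mathcal H)$. It is P-divisible (respectively CP-divisible) if for all $0\le s\le t$ there is a positive (respectively completely positive), trace preserving linear map $\Phi_{t,s}:\mathcal B_1(\mathcal H)\to\mathcal B_1(\mathcal H)$ with $\Lambda_t=\Phi_{t,s}\circ\Lambda_s$. No continuity in $t$ is assumed. At $t=0$ derivatives are right derivatives. **Theorem.** Let $\{\Lambda_t\}_{t\ge0}$ be a dynamical map on $\mathcal B_1(\mathcal H)$. For every $t\ge 0$ there is exactly one linear map $\mathcal I\otimes\Lambda_t$ on $\mathcal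 B_1(\mathcal H\otimes\mathcal H)$ that is bounded in the trace norm and satisfies $(\mathcal I\otimes\Lambda_t)(A\otimes B)=A\otimes\Lambda_t(B)$ for all $A,B\in\mathcal B_1(\mathcal H)$. Moreover: 1. If $\{\Lambda_t\}$ is P-divisible, then for every Hermitian $X\in\mathcal B_1(\mathcal H)$ the function $t\mapsto\|\Lambda_t(X)\|_1$ is non-increasing on $[0,\infty)$, and $\frac{d}{dt}\|\Lambda_t(X)\|_1\le 0$ at every $t\ge0$ at which this derivative exists. 2. If $\{\Lambda_t\}$ is CP-divisible, then for every Hermitian $Y\in\mathcal B_1(\mathcal H\otimes\mathcal H)$ the function $t\mapsto\|(\mathcal I\otimes\Lambda_t)(Y)\|_1$ is non-increasing on $[0,\infty)$, and $\frac{d}{dt}\|(\mathcal I\otimes\Lambda_t)(Y)\|_1\le 0$ at every $t\ge0$ at which this derivative exists. 3. Suppose in addition that every $\Lambda_t$, $t\ge 0$, is surjective. If for every Hermitian $X\in\mathcal B_1(\mathcal H)$ the function $t\mapsto\|\Lambda_t(X)\|_1$ is non-increasing on $[0,\infty)$, or if for every such $X$ it is differentiable on $[0,\infty)$ with derivative $\le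 0$, then $\{\Lambda_t\}$ is P-divisible. If for every Hermitian $Y\in\mathcal B_1(\mathcal H\otimes\mathcal H)$ the function $t\mapsto\|(\mathcal I\otimes\Lambda_t)(Y)\|_1$ is non-increasing on $[0,\infty)$, or if for every such $Y$ it is differentiable on $[0,\infty)$ with derivative $\le0$, then $\{\Lambda_t\}$ is CP-divisible. -/

import Mathlib

open scoped InnerProductSpace TensorProduct ComplexOrder ENNReal

noncomputable section

namespace QuantumDynamics

universe u

/-! ### Hilbert bases and Hilbert-Schmidt sums -/

section Bases

variable {H : Type*} [NormedAddCommGroup H] [InnerProductSpace ℂ H]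

theorem hilbertBasis_tsum_enorm_sq {ι : Type*} (b : HilbertBasis ι ℂ H) (x : H) :
    ∑' i, ‖⟪b i, x⟫_ℂ‖ₑ ^ 2 = ‖x‖ₑ ^ 2 := by
  have h := b.hasSum_inner_mul_inner x x
  have h1 : HasSum (fun i => ‖⟪b i, x⟫_ℂ‖ ^ 2) (‖x‖ ^ 2) := by
    have h2 := h.mapL (RCLike.reCLM : ℂ →L[ℝ] ℝ)
    have h3 : RCLike.reCLM (⟪x, x⟫_ℂ) = ‖x‖ ^ 2 := by
      simpa using (inner_self_eq_norm_sq (𝕜 := ℂ) x)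
    rw [h3] at h2
    have h5 : ∀ i, ‖⟪b i, x⟫_ℂ‖ ^ 2 = RCLike.reCLM (⟪x, b i⟫_ℂ * ⟪b i, x⟫_ℂ) := fun i => by
      rw [← inner_conj_symm x (b i), RCLike.conj_mul]
      simp [← Complex.ofReal_pow]
    simpa only [h5] using h2
  have h4 : (‖x‖ₑ : ℝ≥0∞) ^ 2 = ENNReal.ofReal (‖x‖ ^ 2) := by
    rw [← ofReal_norm, ← ENNReal.ofReal_pow (norm_nonneg _)]
  rw [h4, ← h1.tsum_eq, ENNReal.ofReal_tsum_of_nonneg (fun _ => by positivity) h1.summable]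
  congr 1
  ext i
  rw [← ofReal_norm, ← ENNReal.ofReal_pow (norm_nonneg _)]

variable [CompleteSpace H] {K : Type*} [NormedAddCommGroup K] [InnerProductSpace ℂ K]
  [CompleteSpace K]

theorem tsum_enorm_sq_adjoint {ι κ : Type*} (b : HilbertBasis ι ℂ H) (c : HilbertBasis κ ℂ K)
    (A : H →L[ℂ] K) :
    ∑' i, ‖A (b i)‖ₑ ^ 2 = ∑' j, ‖A.adjoint (c j)‖ₑ ^ 2 := by
  simp_rw [← hilbertBasis_tsum_enorm_sq c, ← hilbertBasis_tsum_enorm_sq b]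
  rw [ENNReal.tsum_comm]
  refine tsum_congr fun j => tsum_congr fun i => ?_
  rw [ContinuousLinearMap.adjoint_inner_right, ← inner_conj_symm]
  congr 1
  rw [← ofReal_norm, ← ofReal_norm, RCLike.norm_conj]

theorem tsum_enorm_sq_comp_ne_top {ι : Type*} (b : HilbertBasis ι ℂ H)
    (W : K →L[ℂ] K) (A : H →L[ℂ] K) (hA : ∑' i, ‖A (b i)‖ₑ ^ 2 ≠ ⊤) :
    ∑' i, ‖(W ∘L A) (b i)‖ₑ ^ 2 ≠ ⊤ := by
  have : ∑' i, ‖(W ∘L A) (b i)‖ₑ ^ 2 ≤ ‖W‖ₑ ^ 2 * ∑' i, ‖A (b i)‖ₑ ^ 2 := by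
    rw [← ENNReal.tsum_mul_left]
    refine ENNReal.tsum_le_tsum fun i => ?_
    rw [← mul_pow]
    gcongr
    exact W.le_opENorm _
  refine ne_top_of_le_ne_top (ENNReal.mul_ne_top ?_ hA) this
  exact ENNReal.pow_ne_top enorm_ne_top

theorem tsum_enorm_inner_ne_top {ι : Type*} (f g : ι → H)
    (hf : ∑' i, ‖f i‖ₑ ^ 2 ≠ ⊤) (hg : ∑' i, ‖g i‖ₑ ^ 2 ≠ ⊤) :
    ∑' i, ‖⟪f i, g i⟫_ℂ‖ₑ ≠ ⊤ := by
  refine ne_top_of_le_ne_top (ENNReal.add_ne_top.2 ⟨hf, hg⟩) ?_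
  rw [← ENNReal.tsum_add]
  refine ENNReal.tsum_le_tsum fun i => ?_
  have h : ‖⟪f i, g i⟫_ℂ‖ ≤ ‖f i‖ ^ 2 + ‖g i‖ ^ 2 := by
    have := norm_inner_le_norm (𝕜 := ℂ) (f i) (g i)
    nlinarith [sq_nonneg (‖f i‖ - ‖g i‖), sq_nonneg (‖f i‖), sq_nonneg (‖g i‖)]
  simp only [← ofReal_norm]
  rw [← ENNReal.ofReal_pow (norm_nonneg _), ← ENNReal.ofReal_pow (norm_nonneg _),
    ← ENNReal.ofReal_add (by positivity) (by positivity)]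
  exact ENNReal.ofReal_le_ofReal h

theorem exists_comp_eq_of_norm_le (A B : H →L[ℂ] H) (h : ∀ x, ‖A x‖ ≤ ‖B x‖) :
    ∃ W : H →L[ℂ] H, W ∘L B = A := by
  let K : Submodule ℂ H := (LinearMap.range (B : H →ₗ[ℂ] H)).topologicalClosure
  have hmem : ∀ x, B x ∈ K := fun x =>
    Submodule.le_topologicalClosure _ (LinearMap.mem_range_self (B : H →ₗ[ℂ] H) x)
  have : CompleteSpace K :=
    (Submodule.isClosed_topologicalClosure _).completeSpace_coe
  let e : H →ₗ[ℂ] K := (B : H →ₗ[ℂ] H).codRestrict K hmem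
  have hdense : DenseRange e := by
    intro y
    rw [Metric.mem_closure_iff]
    intro ε hε
    have hy : (y : H) ∈ closure (LinearMap.range (B : H →ₗ[ℂ] H) : Set H) := y.2
    obtain ⟨z, ⟨x, rfl⟩, hz⟩ := Metric.mem_closure_iff.1 hy ε hε
    exact ⟨e x, ⟨x, rfl⟩, hz⟩
  let V : K →L[ℂ] H := LinearMap.extendOfNorm (A : H →ₗ[ℂ] H) e
  have hV : ∀ x, V (e x) = A x := fun x =>
    LinearMap.extendOfNorm_eq hdense ⟨1, fun x => by simpa [e] using h x⟩ x
  refine ⟨V ∘L K.orthogonalProjectionOnto, ?_⟩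
  ext x
  have : K.orthogonalProjectionOnto (B x) = e x :=
    Submodule.orthogonalProjectionOnto_mem_subspace_eq_self (⟨B x, hmem x⟩ : K)
  simp [this, hV]

end Bases

/-! ### Trace class operators -/

section TraceClass

variable (H : Type*) [NormedAddCommGroup H] [InnerProductSpace ℂ H] [CompleteSpace H]

/-- The index set of a fixed Hilbert (orthonormal) basis of `H`. -/
def basisIndex : Set H := (exists_hilbertBasis ℂ H).choose

/-- A fixed Hilbert (orthonormal) basis of `H`. -/
def basis : HilbertBasis (basisIndex H) ℂ H := (exists_hilbertBasis ℂ H).choose_spec.choose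

variable {H}

/-- `T` is trace class: `Tr |T| < ∞`, where `|T| = (T* T)^(1/2)`. -/
def IsTraceClass (T : H →L[ℂ] H) : Prop :=
  Summable fun i => (⟪basis H i, CFC.abs T (basis H i)⟫_ℂ).re

/-- The trace norm `‖T‖₁ = Tr |T|`. -/
def traceNorm (T : H →L[ℂ] H) : ℝ :=
  ∑' i, (⟪basis H i, CFC.abs T (basis H i)⟫_ℂ).re

/-- The trace `Tr T`. -/
def trace (T : H →L[ℂ] H) : ℂ :=
  ∑' i, ⟪basis H i, T (basis H i)⟫_ℂ

theorem norm_abs_apply (T : H →L[ℂ] H) (x : H) : ‖CFC.abs T x‖ = ‖T x‖ := by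
  have h := CFC.abs_mul_abs T
  have hs : star (CFC.abs T) = CFC.abs T := (CFC.abs_nonneg T).star_eq
  have h2 : ‖CFC.abs T x‖ ^ 2 = ‖T x‖ ^ 2 := by
    have e1 : ⟪CFC.abs T x, CFC.abs T x⟫_ℂ = ⟪T x, T x⟫_ℂ := by
      rw [← ContinuousLinearMap.adjoint_inner_right, ← ContinuousLinearMap.adjoint_inner_right,
        ← ContinuousLinearMap.star_eq_adjoint, ← ContinuousLinearMap.star_eq_adjoint, hs]
      change ⟪x, (CFC.abs T * CFC.abs T) x⟫_ℂ = ⟪x, (star T * T) x⟫_ℂ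
      rw [h]
    rw [inner_self_eq_norm_sq_to_K, inner_self_eq_norm_sq_to_K] at e1
    exact_mod_cast e1
  exact (sq_eq_sq₀ (norm_nonneg _) (norm_nonneg _)).1 h2

theorem exists_abs_factor (T : H →L[ℂ] H) :
    ∃ Q : H →L[ℂ] H, Q.adjoint = Q ∧ Q ∘L Q = CFC.abs T := by
  refine ⟨CFC.sqrt (CFC.abs T), ?_, ?_⟩
  · rw [← ContinuousLinearMap.star_eq_adjoint]
    exact (CFC.sqrt_nonneg (CFC.abs T)).star_eq
  · exact CFC.sqrt_mul_sqrt_self (CFC.abs T) (CFC.abs_nonneg T)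

theorem isTraceClass_of_tsum_ne_top {T : H →L[ℂ] H}
    (h : ∑' i, ‖⟪basis H i, CFC.abs T (basis H i)⟫_ℂ‖ₑ ≠ ⊤) : IsTraceClass T := by
  have h1 : Summable fun i => ⟪basis H i, CFC.abs T (basis H i)⟫_ℂ := by
    refine Summable.of_norm ?_
    have := ENNReal.summable_toReal h
    simpa using this
  exact (h1.mapL (RCLike.reCLM : ℂ →L[ℝ] ℝ) :)

theorem IsTraceClass.exists_factor {T : H →L[ℂ] H} (hT : IsTraceClass T) :
    ∃ A B : H →L[ℂ] H, T = A.adjoint ∘L B ∧ ∑' i, ‖A (basis H i)‖ₑ ^ 2 ≠ ⊤ ∧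
      ∑' i, ‖B (basis H i)‖ₑ ^ 2 ≠ ⊤ := by
  obtain ⟨Q, hQ, hQQ⟩ := exists_abs_factor T
  obtain ⟨W, hW⟩ := exists_comp_eq_of_norm_le T (CFC.abs T) fun x => (norm_abs_apply T x).ge
  have hs : ∑' i, ‖Q (basis H i)‖ₑ ^ 2 ≠ ⊤ := by
    have e : ∀ i, (⟪basis H i, CFC.abs T (basis H i)⟫_ℂ).re = ‖Q (basis H i)‖ ^ 2 := by
      intro i
      rw [← hQQ, ContinuousLinearMap.comp_apply, ← ContinuousLinearMap.adjoint_inner_left, hQ]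
      simpa using (inner_self_eq_norm_sq (𝕜 := ℂ) (Q (basis H i)))
    unfold IsTraceClass at hT
    simp_rw [e] at hT
    have h2 : ∑' i, ‖Q (basis H i)‖ₑ ^ 2 = ∑' i, ENNReal.ofReal (‖Q (basis H i)‖ ^ 2) := by
      refine tsum_congr fun i => ?_
      rw [← ofReal_norm, ← ENNReal.ofReal_pow (norm_nonneg _)]
    rw [h2, ← ENNReal.ofReal_tsum_of_nonneg (fun _ => by positivity) hT]
    exact ENNReal.ofReal_ne_top
  refine ⟨(W ∘L Q).adjoint, Q, ?_, ?_, hs⟩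
  · rw [ContinuousLinearMap.adjoint_adjoint, ContinuousLinearMap.comp_assoc, hQQ, hW]
  · rw [← tsum_enorm_sq_adjoint (basis H) (basis H)]
    exact tsum_enorm_sq_comp_ne_top _ _ _ hs

theorem tsum_comp_factor_ne_top (W A B : H →L[ℂ] H)
    (hA : ∑' i, ‖A (basis H i)‖ₑ ^ 2 ≠ ⊤) (hB : ∑' i, ‖B (basis H i)‖ₑ ^ 2 ≠ ⊤) :
    ∑' i, ‖⟪basis H i, (W ∘L A.adjoint ∘L B) (basis H i)⟫_ℂ‖ₑ ≠ ⊤ := by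
  have h1 : ∀ i, ⟪basis H i, (W ∘L A.adjoint ∘L B) (basis H i)⟫_ℂ
      = ⟪(W ∘L A.adjoint).adjoint (basis H i), B (basis H i)⟫_ℂ := fun i => by
    rw [ContinuousLinearMap.adjoint_inner_left]; rfl
  simp_rw [h1]
  refine tsum_enorm_inner_ne_top _ _ ?_ hB
  rw [← tsum_enorm_sq_adjoint (basis H) (basis H)]
  refine tsum_enorm_sq_comp_ne_top _ _ _ ?_
  rwa [← tsum_enorm_sq_adjoint (basis H) (basis H)]

theorem isTraceClass_iff (T : H →L[ℂ] H) :
    IsTraceClass T ↔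
      ∀ W : H →L[ℂ] H, ∑' i, ‖⟪basis H i, (W ∘L T) (basis H i)⟫_ℂ‖ₑ ≠ ⊤ := by
  constructor
  · intro hT W
    obtain ⟨A, B, rfl, hA, hB⟩ := hT.exists_factor
    exact tsum_comp_factor_ne_top W A B hA hB
  · intro h
    obtain ⟨W, hW⟩ := exists_comp_eq_of_norm_le (CFC.abs T) T fun x => (norm_abs_apply T x).le
    refine isTraceClass_of_tsum_ne_top ?_
    rw [← hW]
    exact h W

theorem isTraceClass_of_factor (A B : H →L[ℂ] H)
    (hA : ∑' i, ‖A (basis H i)‖ₑ ^ 2 ≠ ⊤) (hB : ∑' i, ‖B (basis H i)‖ₑ ^ 2 ≠ ⊤) :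
    IsTraceClass (A.adjoint ∘L B) :=
  (isTraceClass_iff _).2 fun W => tsum_comp_factor_ne_top W A B hA hB

variable (H) in
/-- The space `B₁(H)` of trace class operators on `H`. -/
def TraceClass : Submodule ℂ (H →L[ℂ] H) where
  carrier := {T | IsTraceClass T}
  zero_mem' := by
    refine (isTraceClass_iff _).2 fun W => ?_
    simp
  add_mem' := by
    intro S T hS hT
    refine (isTraceClass_iff _).2 fun W => ?_
    have h1 := (isTraceClass_iff _).1 hS W
    have h2 := (isTraceClass_iff _).1 hT W
    refine ne_top_of_le_ne_top (ENNReal.add_ne_top.2 ⟨h1, h2⟩) ?_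
    rw [← ENNReal.tsum_add]
    refine ENNReal.tsum_le_tsum fun i => ?_
    simp only [ContinuousLinearMap.comp_apply, add_apply, map_add,
      inner_add_right]
    exact enorm_add_le _ _
  smul_mem' := by
    intro c T hT
    refine (isTraceClass_iff _).2 fun W => ?_
    have h1 := (isTraceClass_iff _).1 hT W
    have h2 : ∀ i, ‖⟪basis H i, (W ∘L (c • T)) (basis H i)⟫_ℂ‖ₑ
        = ‖c‖ₑ * ‖⟪basis H i, (W ∘L T) (basis H i)⟫_ℂ‖ₑ := fun i => by
      simp [enorm_mul]
    simp_rw [h2]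
    rw [ENNReal.tsum_mul_left]
    exact ENNReal.mul_ne_top enorm_ne_top h1

end TraceClass

/-! ### Hilbert space tensor products -/

section Tensor

variable (H : Type*) [NormedAddCommGroup H] [InnerProductSpace ℂ H]

/-- The Hilbert space tensor product of `H` with itself: the completion of the algebraic tensor
product for `⟪a ⊗ b, c ⊗ d⟫ = ⟪a, c⟫ ⟪b, d⟫`. -/
abbrev HilbertTensor : Type _ := UniformSpace.Completion (H ⊗[ℂ] H)

variable {H}

/-- The elementary tensor `x ⊗ y`. -/
def vtmul (x y : H) : HilbertTensor H := ((x ⊗ₜ[ℂ] y : H ⊗[ℂ] H) : HilbertTensor H)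

/-- The operator `A ⊗ B`: the bounded operator with `(A ⊗ B) (x ⊗ y) = A x ⊗ B y`. -/
def optmul (A B : H →L[ℂ] H) : HilbertTensor H →L[ℂ] HilbertTensor H :=
  (TensorProduct.mapL A B).completion

theorem inner_vtmul (x y z w : H) :
    ⟪vtmul x y, vtmul z w⟫_ℂ = ⟪x, z⟫_ℂ * ⟪y, w⟫_ℂ := by
  simp [vtmul, UniformSpace.Completion.inner_coe]

theorem optmul_vtmul (A B : H →L[ℂ] H) (x y : H) :
    optmul A B (vtmul x y) = vtmul (A x) (B y) := by
  simp [optmul, vtmul]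

theorem enorm_vtmul (x y : H) : ‖vtmul x y‖ₑ = ‖x‖ₑ * ‖y‖ₑ := by
  have h : ‖vtmul x y‖ = ‖x‖ * ‖y‖ := by
    rw [vtmul, UniformSpace.Completion.norm_coe, TensorProduct.norm_tmul]
  rw [← ofReal_norm, h, ENNReal.ofReal_mul (norm_nonneg _), ofReal_norm,
    ofReal_norm]

/-- Two bounded operators on `H ⊗ H` that agree on elementary tensors are equal. -/
theorem operator_ext {S T : HilbertTensor H →L[ℂ] HilbertTensor H}
    (h : ∀ x y, S (vtmul x y) = T (vtmul x y)) : S = T := by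
  ext z
  induction z using UniformSpace.Completion.induction_on with
  | hp => exact isClosed_eq S.continuous T.continuous
  | ih z =>
    induction z using TensorProduct.induction_on with
    | zero => rw [UniformSpace.Completion.coe_zero, map_zero, map_zero]
    | tmul x y => exact h x y
    | add a b ha hb => rw [UniformSpace.Completion.coe_add, map_add, map_add, ha, hb]

variable [CompleteSpace H]

theorem eq_of_inner_vtmul {u v : HilbertTensor H}
    (h : ∀ x y, ⟪u, vtmul x y⟫_ℂ = ⟪v, vtmul x y⟫_ℂ) : u = v := by
  refine ext_inner_right ℂ fun z => ?_
  induction z using UniformSpace.Completion.induction_on with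
  | hp => exact isClosed_eq (by fun_prop) (by fun_prop)
  | ih z =>
    induction z using TensorProduct.induction_on with
    | zero => rw [UniformSpace.Completion.coe_zero, inner_zero_right, inner_zero_right]
    | tmul x y => exact h x y
    | add a b ha hb =>
      rw [UniformSpace.Completion.coe_add, inner_add_right, inner_add_right, ha, hb]

theorem adjoint_optmul (A B : H →L[ℂ] H) :
    (optmul A B).adjoint = optmul A.adjoint B.adjoint := by
  refine operator_ext fun x y => eq_of_inner_vtmul fun z w => ?_
  rw [ContinuousLinearMap.adjoint_inner_left, optmul_vtmul, optmul_vtmul, inner_vtmul, inner_vtmul,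
    ContinuousLinearMap.adjoint_inner_left, ContinuousLinearMap.adjoint_inner_left]

theorem optmul_comp (A B C D : H →L[ℂ] H) :
    optmul (A ∘L B) (C ∘L D) = optmul A C ∘L optmul B D := by
  refine operator_ext fun x y => ?_
  simp [optmul_vtmul]

variable (H) in
theorem exists_tensor_hilbertBasis :
    ∃ b : HilbertBasis (basisIndex H × basisIndex H) ℂ (HilbertTensor H),
      ∀ p, b p = vtmul (basis H p.1) (basis H p.2) := by
  have hon : Orthonormal ℂ
      fun p : basisIndex H × basisIndex H => vtmul (basis H p.1) (basis H p.2) := by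
    classical
    rw [orthonormal_iff_ite]
    rintro ⟨i, j⟩ ⟨k, l⟩
    rw [inner_vtmul, orthonormal_iff_ite.1 (basis H).orthonormal,
      orthonormal_iff_ite.1 (basis H).orthonormal]
    by_cases h1 : i = k <;> by_cases h2 : j = l <;> simp [h1, h2]
  refine ⟨HilbertBasis.mkOfOrthogonalEqBot hon ?_, fun p => by rw [HilbertBasis.coe_mkOfOrthogonalEqBot]⟩
  rw [Submodule.eq_bot_iff]
  intro u hu
  have h0 : ∀ i j, ⟪u, vtmul (basis H i) (basis H j)⟫_ℂ = 0 := fun i j =>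
    (Submodule.mem_orthogonal' _ _).1 hu _ (Submodule.subset_span ⟨(i, j), rfl⟩)
  let f : H →L[ℂ] H →L[ℂ] ℂ :=
    (ContinuousLinearMap.compL ℂ H (H ⊗[ℂ] H) ℂ
      ((innerSL ℂ u) ∘L (UniformSpace.Completion.toComplL))) ∘L TensorProduct.mkL ℂ H H
  have hf : ∀ x y, f x y = ⟪u, vtmul x y⟫_ℂ := fun x y => rfl
  have hz : ∀ g : H →L[ℂ] ℂ, (∀ i, g (basis H i) = 0) → g = 0 := by
    intro g hg
    refine ContinuousLinearMap.ext_on (s := Set.range (basis H)) ?_ ?_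
    · rw [dense_iff_closure_eq, ← Submodule.topologicalClosure_coe, (basis H).dense_span]
      rfl
    · rintro _ ⟨i, rfl⟩
      simpa using hg i
  have h1 : ∀ i, f (basis H i) = 0 := fun i => hz _ fun j => by rw [hf]; exact h0 i j
  refine eq_of_inner_vtmul fun x y => ?_
  rw [inner_zero_left, ← hf]
  have h2 := hz (f.flip y) fun i => by rw [ContinuousLinearMap.flip_apply, h1 i]; rfl
  rw [← ContinuousLinearMap.flip_apply, h2]; rfl

theorem tsum_enorm_sq_optmul_ne_top (A B : H →L[ℂ] H)
    (hA : ∑' i, ‖A (basis H i)‖ₑ ^ 2 ≠ ⊤) (hB : ∑' i, ‖B (basis H i)‖ₑ ^ 2 ≠ ⊤) :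
    ∑' i, ‖optmul A B (basis (HilbertTensor H) i)‖ₑ ^ 2 ≠ ⊤ := by
  obtain ⟨b, hb⟩ := exists_tensor_hilbertBasis H
  rw [tsum_enorm_sq_adjoint _ b, ← tsum_enorm_sq_adjoint b b]
  have : ∑' p, ‖optmul A B (b p)‖ₑ ^ 2
      = (∑' i, ‖A (basis H i)‖ₑ ^ 2) * ∑' i, ‖B (basis H i)‖ₑ ^ 2 := by
    rw [ENNReal.tsum_prod', ← ENNReal.tsum_mul_right]
    refine tsum_congr fun i => ?_
    rw [← ENNReal.tsum_mul_left]
    refine tsum_congr fun j => ?_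
    rw [hb, optmul_vtmul, enorm_vtmul, mul_pow]
  rw [this]
  exact ENNReal.mul_ne_top hA hB

theorem IsTraceClass.optmul {A B : H →L[ℂ] H} (hA : IsTraceClass A) (hB : IsTraceClass B) :
    IsTraceClass (optmul A B) := by
  obtain ⟨A₁, A₂, rfl, h1, h2⟩ := hA.exists_factor
  obtain ⟨B₁, B₂, rfl, h3, h4⟩ := hB.exists_factor
  rw [optmul_comp, ← adjoint_optmul]
  exact isTraceClass_of_factor _ _ (tsum_enorm_sq_optmul_ne_top _ _ h1 h3)
    (tsum_enorm_sq_optmul_ne_top _ _ h2 h4)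

/-- The trace class operator `A ⊗ B` on `H ⊗ H`, for trace class operators `A`, `B` on `H`. -/
def tctmul (A B : TraceClass H) : TraceClass (HilbertTensor H) :=
  ⟨optmul (A : H →L[ℂ] H) (B : H →L[ℂ] H), IsTraceClass.optmul A.2 B.2⟩

end Tensor

/-! ### Maps on trace class operators, dynamical maps and divisibility -/

section Dynamical

variable {H : Type*} [NormedAddCommGroup H] [InnerProductSpace ℂ H] [CompleteSpace H]

/-- `Φ` maps positive operators to positive operators. -/
def IsPositiveMap (Φ : TraceClass H →ₗ[ℂ] TraceClass H) : Prop :=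
  ∀ X : TraceClass H, (X : H →L[ℂ] H).IsPositive → (Φ X : H →L[ℂ] H).IsPositive

/-- The block operator matrix `(T i j)` is a positive operator on `H ⊕ ⋯ ⊕ H` (`n` summands). -/
def IsPositiveBlock {n : ℕ} (T : Fin n → Fin n → TraceClass H) : Prop :=
  ∀ x : Fin n → H, 0 ≤ ∑ i, ∑ j, ⟪x i, (T i j : H →L[ℂ] H) (x j)⟫_ℂ

/-- `Φ` is completely positive: for every `n`, the map `id ⊗ Φ` on the `n × n` matrices over
`B₁(H)` is positive. -/
def IsCompletelyPositive (Φ : TraceClass H →ₗ[ℂ] TraceClass H) : Prop :=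
  ∀ (n : ℕ) (T : Fin n → Fin n → TraceClass H),
    IsPositiveBlock T → IsPositiveBlock fun i j => Φ (T i j)

/-- `Tr (Φ X) = Tr X` for all `X`. -/
def IsTracePreserving (Φ : TraceClass H →ₗ[ℂ] TraceClass H) : Prop :=
  ∀ X : TraceClass H, trace (Φ X : H →L[ℂ] H) = trace (X : H →L[ℂ] H)

/-- A dynamical map `{Λ_t}_{t ≥ 0}`. Only the values `Λ t` with `t ≥ 0` matter, here and below. -/
def IsDynamicalMap (Λ : ℝ → TraceClass H →ₗ[ℂ] TraceClass H) : Prop :=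
  ∀ t, 0 ≤ t → IsCompletelyPositive (Λ t) ∧ IsTracePreserving (Λ t)

def IsPDivisible (Λ : ℝ → TraceClass H →ₗ[ℂ] TraceClass H) : Prop :=
  ∀ s t, 0 ≤ s → s ≤ t → ∃ Φ : TraceClass H →ₗ[ℂ] TraceClass H,
    IsPositiveMap Φ ∧ IsTracePreserving Φ ∧ Λ t = Φ ∘ₗ Λ s

def IsCPDivisible (Λ : ℝ → TraceClass H →ₗ[ℂ] TraceClass H) : Prop :=
  ∀ s t, 0 ≤ s → s ≤ t → ∃ Φ : TraceClass H →ₗ[ℂ] TraceClass H,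
    IsCompletelyPositive Φ ∧ IsTracePreserving Φ ∧ Λ t = Φ ∘ₗ Λ s

/-- `Ψ` is the map `I ⊗ Φ` on `B₁(H ⊗ H)`: it is bounded for the trace norm, and
`Ψ (A ⊗ B) = A ⊗ Φ B` for all trace class `A`, `B`. -/
def IsIdTensor (Φ : TraceClass H →ₗ[ℂ] TraceClass H)
    (Ψ : TraceClass (HilbertTensor H) →ₗ[ℂ] TraceClass (HilbertTensor H)) : Prop :=
  (∃ C : ℝ, ∀ Y : TraceClass (HilbertTensor H),
      traceNorm (Ψ Y : HilbertTensor H →L[ℂ] HilbertTensor H) ≤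
        C * traceNorm (Y : HilbertTensor H →L[ℂ] HilbertTensor H)) ∧
    ∀ A B : TraceClass H, Ψ (tctmul A B) = tctmul A (Φ B)

open Classical in
/-- The map `I ⊗ Φ` on `B₁(H ⊗ H)` (and `0` if there is no bounded such map, which does not happen
for a completely positive `Φ`). -/
def idTensor (Φ : TraceClass H →ₗ[ℂ] TraceClass H) :
    TraceClass (HilbertTensor H) →ₗ[ℂ] TraceClass (HilbertTensor H) :=
  if h : ∃ Ψ, IsIdTensor Φ Ψ then h.choose else 0

/-- The function `t ↦ ‖Λ_t X‖₁`. -/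
def normAlong (Λ : ℝ → TraceClass H →ₗ[ℂ] TraceClass H) (X : TraceClass H) (t : ℝ) : ℝ :=
  traceNorm (Λ t X : H →L[ℂ] H)

end Dynamical

end QuantumDynamics

end

/-!
The argument rests on three facts about the trace norm. A trace class operator is a product `A* B`
of Hilbert-Schmidt operators with `‖A‖²`, `‖B‖² ≤ ‖T‖₁`, and conversely `‖A* B‖₁ ≤ ‖A‖ ‖B‖` in the
Hilbert-Schmidt norm; the trace norm is the supremum of finite partial sums of `Tr (W T)` over
contractions `W` (`traceNorm_le_of_forall_contraction`, `norm_sum_inner_comp_le`), hence a norm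
which is lower semicontinuous for the weak operator topology; and a Hermitian operator is a
difference of positive ones whose traces add up to its trace norm (`exists_pos_sub_pos`).

*Contractivity.* By the last fact, a positive trace preserving map does not increase the trace
norm of Hermitian operators, which gives monotonicity in the P-divisible case.

*The map `I ⊗ Φ`.* Relative to a basis `(eᵢ)` of the first factor, an operator `Y` on `H ⊗ H` has
blocks `Yᵢⱼ`. For a finite index set `F` the map `Y ↦ ∑ |eᵢ⟩⟨eⱼ| ⊗ Φ(Yᵢⱼ)` is positive, by
complete positivity of `Φ`, and does not increase the trace of positive operators. So these maps
are bounded uniformly in `F`, and a weak limit along an ultrafilter is a bounded map with `A ⊗ B ↦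
A ⊗ Φ B` (`exists_isIdTensor`). It is unique, since the finite corners of a trace class operator
relative to the product basis converge to it in trace norm and are combinations of operators `A ⊗
B` (`tendsto_traceNorm_sub_corner`, `IsIdTensor.unique`). Uniqueness makes `Φ ↦ I ⊗ Φ`
multiplicative, which gives monotonicity in the CP-divisible case.

*Converses.* If `‖Λₜ X‖₁ ≤ ‖Λₛ X‖₁` for Hermitian `X`, the kernel of `Λₛ` lies in that of `Λₜ`, so
that `Λₜ = Φ Λₛ` for a map `Φ`, as `Λₛ` is surjective. If `Λₛ X ≥ 0`, then `‖Λₜ X‖₁ ≤ ‖Λₛ X‖₁ = Tr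
Λₛ X = Tr Λₜ X`, and a Hermitian operator whose trace norm is at most its trace is positive; hence
`Φ` is positive (`isPositive_map_of_traceNorm_le`). Applied to `I ⊗ Λₜ`, the same argument shows
that `∑ |eₖ⟩⟨eₗ| ⊗ Φ(Sₖₗ)` is positive for every positive block matrix `S` and every orthonormal
family `e` in `H`, and this suffices for complete positivity
(`isCompletelyPositive_of_orthonormal`).
-/

namespace QuantumDynamics

/-! ### Hilbert-Schmidt sums and the variational description of the trace norm -/

section HilbertSchmidt

variable {H : Type*} [NormedAddCommGroup H] [InnerProductSpace ℂ H] [CompleteSpace H]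

/-- The square `∑ ‖A eᵢ‖²` of the Hilbert-Schmidt norm of `A`, with values in `[0, ∞]`. -/
noncomputable def hsSq (A : H →L[ℂ] H) : ℝ≥0∞ := ∑' i, ‖A (basis H i)‖ₑ ^ 2

theorem hsSq_adjoint (A : H →L[ℂ] H) : hsSq A.adjoint = hsSq A :=
  (tsum_enorm_sq_adjoint (basis H) (basis H) A).symm

theorem tsum_enorm_sq_eq_hsSq {ι : Type*} (b : HilbertBasis ι ℂ H) (A : H →L[ℂ] H) :
    ∑' i, ‖A (b i)‖ₑ ^ 2 = hsSq A := by
  rw [tsum_enorm_sq_adjoint b (basis H), ← hsSq_adjoint]; rfl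

theorem hsSq_comp_le (W A : H →L[ℂ] H) : hsSq (W ∘L A) ≤ ‖W‖ₑ ^ 2 * hsSq A := by
  rw [hsSq, hsSq, ← ENNReal.tsum_mul_left]
  refine ENNReal.tsum_le_tsum fun i => ?_
  rw [← mul_pow]
  gcongr
  exact W.le_opENorm _

theorem hsSq_comp_le_left (A W : H →L[ℂ] H) : hsSq (A ∘L W) ≤ ‖W‖ₑ ^ 2 * hsSq A := by
  rw [← hsSq_adjoint, ContinuousLinearMap.adjoint_comp, ← hsSq_adjoint A]
  refine (hsSq_comp_le _ _).trans_eq ?_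
  rw [← ofReal_norm, LinearIsometryEquiv.norm_map, ofReal_norm]

theorem hsSq_comp_adjoint_le {W : H →L[ℂ] H} (hW : ‖W‖ ≤ 1) (A : H →L[ℂ] H) :
    hsSq (A ∘L W.adjoint) ≤ hsSq A := by
  refine (hsSq_comp_le_left _ _).trans ?_
  have : ‖W.adjoint‖ₑ ≤ 1 := by
    rw [← ofReal_norm, LinearIsometryEquiv.norm_map]
    simpa using ENNReal.ofReal_le_ofReal hW
  calc ‖W.adjoint‖ₑ ^ 2 * hsSq A ≤ 1 ^ 2 * hsSq A := by gcongr
    _ = _ := by simp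

theorem hasSum_of_hsSq_ne_top {ι : Type*} (b : HilbertBasis ι ℂ H) {A : H →L[ℂ] H}
    (hA : hsSq A ≠ ⊤) : HasSum (fun i => ‖A (b i)‖ ^ 2) (hsSq A).toReal := by
  rw [← tsum_enorm_sq_eq_hsSq b] at hA ⊢
  rw [ENNReal.tsum_toReal_eq fun i => by finiteness]
  simpa using ENNReal.hasSum_toReal hA

theorem norm_sq_le_hsSq {A : H →L[ℂ] H} (hA : hsSq A ≠ ⊤) : ‖A‖ ^ 2 ≤ (hsSq A).toReal := by
  have h : ‖A‖ ≤ √(hsSq A).toReal := by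
    rw [← LinearIsometryEquiv.norm_map ContinuousLinearMap.adjoint A]
    refine ContinuousLinearMap.opNorm_le_bound _ (Real.sqrt_nonneg _) fun x => ?_
    have h1 : ‖A.adjoint x‖ₑ ^ 2 ≤ ‖x‖ₑ ^ 2 * hsSq A := by
      rw [← hilbertBasis_tsum_enorm_sq (basis H), hsSq, ← ENNReal.tsum_mul_left]
      refine ENNReal.tsum_le_tsum fun i => ?_
      rw [ContinuousLinearMap.adjoint_inner_right, ← mul_pow, ← ofReal_norm, ← ofReal_norm x,
        ← ofReal_norm (A _), ← ENNReal.ofReal_mul (norm_nonneg _), mul_comm]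
      gcongr
      exact norm_inner_le_norm _ _
    have h2 := ENNReal.toReal_mono (ENNReal.mul_ne_top (by finiteness) hA) h1
    simp only [ENNReal.toReal_pow, ENNReal.toReal_mul, toReal_enorm] at h2
    refine abs_le_of_sq_le_sq' ?_ (by positivity) |>.2
    rw [mul_pow, Real.sq_sqrt ENNReal.toReal_nonneg]
    linarith
  calc ‖A‖ ^ 2 ≤ √(hsSq A).toReal ^ 2 := by gcongr
    _ = _ := Real.sq_sqrt ENNReal.toReal_nonneg

/-- The operator `W` of `exists_comp_eq_of_norm_le` may be taken to be a contraction. -/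
theorem exists_contraction_comp_eq (A B : H →L[ℂ] H) (h : ∀ x, ‖A x‖ ≤ ‖B x‖) :
    ∃ W : H →L[ℂ] H, ‖W‖ ≤ 1 ∧ W ∘L B = A := by
  obtain ⟨V, hV⟩ := exists_comp_eq_of_norm_le A B h
  -- compress `V` to the closure of the range of `B`, where it is bounded by `1`
  let K : Submodule ℂ H := (LinearMap.range (B : H →ₗ[ℂ] H)).topologicalClosure
  have : CompleteSpace K := (Submodule.isClosed_topologicalClosure _).completeSpace_coe
  have hK : ∀ y ∈ K, ‖V y‖ ≤ ‖y‖ := by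
    intro y hy
    have hcl : IsClosed {y | ‖V y‖ ≤ ‖y‖} := isClosed_le (by fun_prop) (by fun_prop)
    refine (closure_minimal ?_ hcl) hy
    rintro _ ⟨x, rfl⟩
    have : V (B x) = A x := by rw [← hV]; rfl
    simpa [this] using h x
  refine ⟨V ∘L K.starProjection, ?_, ?_⟩
  · refine ContinuousLinearMap.opNorm_le_bound _ zero_le_one fun x => ?_
    rw [one_mul]
    exact (hK _ (K.starProjection_apply_mem x)).trans (K.norm_starProjection_apply_le x)
  · ext x
    have hx : B x ∈ K := Submodule.le_topologicalClosure _ (LinearMap.mem_range_self _ x)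
    have h1 : K.starProjection (B x) = B x := Submodule.starProjection_eq_self_iff.2 hx
    simp only [ContinuousLinearMap.comp_apply, h1]
    rw [← hV]; rfl

theorem abs_isPositive (T : H →L[ℂ] H) : (CFC.abs T).IsPositive :=
  (ContinuousLinearMap.nonneg_iff_isPositive _).1 (CFC.abs_nonneg T)

theorem abs_eq_self_of_isPositive {T : H →L[ℂ] H} (hT : T.IsPositive) : CFC.abs T = T :=
  CFC.abs_of_nonneg T ((ContinuousLinearMap.nonneg_iff_isPositive _).2 hT)

theorem isTraceClass_abs {T : H →L[ℂ] H} (hT : IsTraceClass T) : IsTraceClass (CFC.abs T) := by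
  unfold IsTraceClass
  rw [CFC.abs_of_nonneg _ (CFC.abs_nonneg T)]
  exact hT

theorem traceNorm_abs (T : H →L[ℂ] H) : traceNorm (CFC.abs T) = traceNorm T := by
  unfold traceNorm
  rw [CFC.abs_of_nonneg _ (CFC.abs_nonneg T)]

/-- For `T` trace class, the square root of `|T|` is a Hilbert-Schmidt operator, and the square of
its Hilbert-Schmidt norm is `Tr |T|`. -/
theorem IsTraceClass.exists_sqrt {T : H →L[ℂ] H} (hT : IsTraceClass T) :
    ∃ Q : H →L[ℂ] H, Q.adjoint = Q ∧ Q ∘L Q = CFC.abs T ∧ hsSq Q ≠ ⊤ ∧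
      (hsSq Q).toReal = traceNorm T := by
  obtain ⟨Q, hQ, hQQ⟩ := exists_abs_factor T
  have e : ∀ i, (⟪basis H i, CFC.abs T (basis H i)⟫_ℂ).re = ‖Q (basis H i)‖ ^ 2 := by
    intro i
    rw [← hQQ, ContinuousLinearMap.comp_apply, ← ContinuousLinearMap.adjoint_inner_left, hQ]
    simpa using (inner_self_eq_norm_sq (𝕜 := ℂ) (Q (basis H i)))
  unfold IsTraceClass at hT
  simp_rw [e] at hT
  have h2 : hsSq Q = ENNReal.ofReal (∑' i, ‖Q (basis H i)‖ ^ 2) := by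
    rw [ENNReal.ofReal_tsum_of_nonneg (fun _ => by positivity) hT]
    refine tsum_congr fun i => ?_
    rw [← ofReal_norm, ← ENNReal.ofReal_pow (norm_nonneg _)]
  refine ⟨Q, hQ, hQQ, by rw [h2]; exact ENNReal.ofReal_ne_top, ?_⟩
  unfold traceNorm
  simp_rw [e]
  rw [h2, ENNReal.toReal_ofReal (tsum_nonneg fun _ => by positivity)]

theorem traceNorm_nonneg (T : H →L[ℂ] H) : 0 ≤ traceNorm T :=
  tsum_nonneg fun i => by
    simpa using (abs_isPositive T).re_inner_nonneg_right (basis H i)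

/-- A trace class operator is a product of two Hilbert-Schmidt operators, both with squared
Hilbert-Schmidt norm at most its trace norm. -/
theorem IsTraceClass.exists_factor_le {T : H →L[ℂ] H} (hT : IsTraceClass T) :
    ∃ A B : H →L[ℂ] H, T = A.adjoint ∘L B ∧ hsSq A ≠ ⊤ ∧ hsSq B ≠ ⊤ ∧
      (hsSq A).toReal ≤ traceNorm T ∧ (hsSq B).toReal ≤ traceNorm T := by
  obtain ⟨Q, hQ, hQQ, hs, hn⟩ := hT.exists_sqrt
  obtain ⟨W, hW1, hW⟩ :=
    exists_contraction_comp_eq T (CFC.abs T) fun x => (norm_abs_apply T x).ge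
  have hle : hsSq (W ∘L Q).adjoint ≤ hsSq Q := by
    rw [ContinuousLinearMap.adjoint_comp, hQ]
    exact hsSq_comp_adjoint_le hW1 Q
  refine ⟨(W ∘L Q).adjoint, Q, ?_, ne_top_of_le_ne_top hs hle, hs, ?_, hn.le⟩
  · rw [ContinuousLinearMap.adjoint_adjoint, ContinuousLinearMap.comp_assoc, hQQ, hW]
  · rw [← hn]
    exact ENNReal.toReal_mono hs hle

theorem sum_norm_inner_factor_le {ι : Type*} (b : HilbertBasis ι ℂ H) {A B : H →L[ℂ] H}
    (hA : hsSq A ≠ ⊤) (hB : hsSq B ≠ ⊤) (F : Finset ι) :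
    ∑ i ∈ F, ‖⟪b i, (A.adjoint ∘L B) (b i)⟫_ℂ‖ ≤ √(hsSq A).toReal * √(hsSq B).toReal := by
  calc ∑ i ∈ F, ‖⟪b i, (A.adjoint ∘L B) (b i)⟫_ℂ‖
      ≤ ∑ i ∈ F, √(‖A (b i)‖ ^ 2) * √(‖B (b i)‖ ^ 2) := by
        refine Finset.sum_le_sum fun i _ => ?_
        rw [ContinuousLinearMap.comp_apply, ContinuousLinearMap.adjoint_inner_right,
          Real.sqrt_sq (norm_nonneg _), Real.sqrt_sq (norm_nonneg _)]
        exact norm_inner_le_norm _ _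
    _ ≤ √(∑ i ∈ F, ‖A (b i)‖ ^ 2) * √(∑ i ∈ F, ‖B (b i)‖ ^ 2) := by
        have := Real.sum_sqrt_mul_sqrt_le F (f := fun i => ‖A (b i)‖ ^ 2)
          (g := fun i => ‖B (b i)‖ ^ 2) (fun _ => by positivity) (fun _ => by positivity)
        exact this
    _ ≤ _ := by
        gcongr
        · exact sum_le_hasSum F (fun _ _ => by positivity) (hasSum_of_hsSq_ne_top b hA)
        · exact sum_le_hasSum F (fun _ _ => by positivity) (hasSum_of_hsSq_ne_top b hB)

/-- If all finite partial sums of `Tr (W T)`, over all contractions `W`, are bounded by `C`, then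
`T` is trace class with trace norm at most `C`. As these sums are continuous in `T` for the weak
operator topology, this makes the trace norm lower semicontinuous. -/
theorem traceNorm_le_of_forall_contraction {T : H →L[ℂ] H} {C : ℝ}
    (h : ∀ W : H →L[ℂ] H, ‖W‖ ≤ 1 → ∀ F : Finset (basisIndex H),
      ‖∑ i ∈ F, ⟪basis H i, W (T (basis H i))⟫_ℂ‖ ≤ C) :
    IsTraceClass T ∧ traceNorm T ≤ C := by
  obtain ⟨W, hW1, hW⟩ :=
    exists_contraction_comp_eq (CFC.abs T) T fun x => (norm_abs_apply T x).le
  have hpos : ∀ i, 0 ≤ (⟪basis H i, CFC.abs T (basis H i)⟫_ℂ).re := fun i => by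
    simpa using (abs_isPositive T).re_inner_nonneg_right (basis H i)
  have hF : ∀ F : Finset (basisIndex H),
      ∑ i ∈ F, (⟪basis H i, CFC.abs T (basis H i)⟫_ℂ).re ≤ C := by
    intro F
    refine le_trans ?_ (h W hW1 F)
    rw [← Complex.re_sum]
    refine (Complex.re_le_norm _).trans_eq ?_
    rw [← hW]; rfl
  have hs : IsTraceClass T := summable_of_sum_le hpos hF
  exact ⟨hs, hs.tsum_le_of_sum_le hF⟩

theorem isTraceClass_and_traceNorm_factor_le {A B : H →L[ℂ] H}
    (hA : hsSq A ≠ ⊤) (hB : hsSq B ≠ ⊤) :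
    IsTraceClass (A.adjoint ∘L B) ∧
      traceNorm (A.adjoint ∘L B) ≤ √(hsSq A).toReal * √(hsSq B).toReal := by
  refine traceNorm_le_of_forall_contraction fun W hW F => ?_
  have hle : hsSq (A ∘L W.adjoint) ≤ hsSq A := hsSq_comp_adjoint_le hW A
  refine (norm_sum_le _ _).trans ?_
  have h1 := sum_norm_inner_factor_le (basis H) (ne_top_of_le_ne_top hA hle) hB F
  rw [ContinuousLinearMap.adjoint_comp, ContinuousLinearMap.adjoint_adjoint] at h1
  refine h1.trans ?_
  gcongr

theorem IsTraceClass.adjoint {T : H →L[ℂ] H} (hT : IsTraceClass T) :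
    IsTraceClass T.adjoint := by
  obtain ⟨A, B, rfl, hA, hB, -, -⟩ := hT.exists_factor_le
  rw [ContinuousLinearMap.adjoint_comp, ContinuousLinearMap.adjoint_adjoint]
  exact (isTraceClass_and_traceNorm_factor_le hB hA).1

theorem traceNorm_adjoint_le {T : H →L[ℂ] H} (hT : IsTraceClass T) :
    traceNorm T.adjoint ≤ traceNorm T := by
  obtain ⟨A, B, h, hA, hB, hA', hB'⟩ := hT.exists_factor_le
  have h1 := (isTraceClass_and_traceNorm_factor_le hB hA).2
  have h2 : T.adjoint = B.adjoint ∘L A := by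
    rw [h, ContinuousLinearMap.adjoint_comp, ContinuousLinearMap.adjoint_adjoint]
  rw [h2]
  refine h1.trans ?_
  calc _ ≤ √(traceNorm T) * √(traceNorm T) := by gcongr
    _ = _ := Real.mul_self_sqrt (traceNorm_nonneg _)

/-- The converse of `traceNorm_le_of_forall_contraction`. -/
theorem norm_sum_inner_comp_le {T : H →L[ℂ] H} (hT : IsTraceClass T) {W : H →L[ℂ] H}
    (hW : ‖W‖ ≤ 1) {ι : Type*} (b : HilbertBasis ι ℂ H) (F : Finset ι) :
    ‖∑ i ∈ F, ⟪b i, W (T (b i))⟫_ℂ‖ ≤ traceNorm T := by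
  obtain ⟨A, B, h, hA, hB, hA', hB'⟩ := hT.exists_factor_le
  have hle : hsSq (A ∘L W.adjoint) ≤ hsSq A := hsSq_comp_adjoint_le hW A
  refine (norm_sum_le _ _).trans ?_
  have h1 := sum_norm_inner_factor_le b (ne_top_of_le_ne_top hA hle) hB F
  rw [ContinuousLinearMap.adjoint_comp, ContinuousLinearMap.adjoint_adjoint] at h1
  have h2 : ∀ x, W (T x) = ((W ∘L A.adjoint) ∘L B) x := fun x => by rw [h]; rfl
  simp_rw [h2]
  refine h1.trans ?_
  calc _ ≤ √(traceNorm T) * √(traceNorm T) := by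
        gcongr
        exact (ENNReal.toReal_mono hA hle).trans hA'
    _ = _ := Real.mul_self_sqrt (traceNorm_nonneg _)

theorem traceNorm_add_le {S T : H →L[ℂ] H} (hS : IsTraceClass S) (hT : IsTraceClass T) :
    traceNorm (S + T) ≤ traceNorm S + traceNorm T := by
  refine (traceNorm_le_of_forall_contraction fun W hW F => ?_).2
  simp only [add_apply, map_add, inner_add_right, Finset.sum_add_distrib]
  exact (norm_add_le _ _).trans
    (add_le_add (norm_sum_inner_comp_le hS hW _ F) (norm_sum_inner_comp_le hT hW _ F))

theorem traceNorm_smul_le (c : ℂ) {T : H →L[ℂ] H} (hT : IsTraceClass T) :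
    traceNorm (c • T) ≤ ‖c‖ * traceNorm T := by
  refine (traceNorm_le_of_forall_contraction fun W hW F => ?_).2
  simp only [smul_apply, map_smul, inner_smul_right, ← Finset.mul_sum, norm_mul]
  gcongr
  exact norm_sum_inner_comp_le hT hW _ F

theorem traceNorm_neg (T : H →L[ℂ] H) : traceNorm (-T) = traceNorm T := by
  unfold traceNorm
  rw [CFC.abs_neg]

theorem traceNorm_zero : traceNorm (0 : H →L[ℂ] H) = 0 := by
  simp [traceNorm]

theorem traceNorm_sub_le {S T : H →L[ℂ] H} (hS : IsTraceClass S) (hT : IsTraceClass T) :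
    traceNorm (S - T) ≤ traceNorm S + traceNorm T := by
  rw [sub_eq_add_neg, ← traceNorm_neg T]
  exact traceNorm_add_le hS ((TraceClass H).neg_mem hT)

theorem norm_le_traceNorm {T : H →L[ℂ] H} (hT : IsTraceClass T) : ‖T‖ ≤ traceNorm T := by
  obtain ⟨A, B, h, hA, hB, hA', hB'⟩ := hT.exists_factor_le
  have h1 := (norm_sq_le_hsSq hA).trans hA'
  have h2 := (norm_sq_le_hsSq hB).trans hB'
  have h3 : ‖T‖ ≤ ‖A‖ * ‖B‖ := by
    rw [h]
    refine (ContinuousLinearMap.opNorm_comp_le _ _).trans_eq ?_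
    rw [LinearIsometryEquiv.norm_map]
  nlinarith [sq_nonneg (‖A‖ - ‖B‖)]

theorem eq_zero_of_traceNorm_le_zero {T : H →L[ℂ] H} (hT : IsTraceClass T)
    (h : traceNorm T ≤ 0) : T = 0 :=
  norm_le_zero_iff.1 ((norm_le_traceNorm hT).trans h)

end HilbertSchmidt

/-! ### Positive trace class operators and the trace -/

section Trace

variable {H : Type*} [NormedAddCommGroup H] [InnerProductSpace ℂ H] [CompleteSpace H]

theorem isPositive_of_inner_nonneg {E : Type*} [NormedAddCommGroup E] [InnerProductSpace ℂ E]
    {T : E →L[ℂ] E} (h : ∀ x, 0 ≤ ⟪x, T x⟫_ℂ) :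
    T.IsPositive := by
  rw [ContinuousLinearMap.isPositive_iff_complex]
  intro x
  have h1 := h x
  have h2 : ⟪T x, x⟫_ℂ = ⟪x, T x⟫_ℂ := by
    rw [← inner_conj_symm, Complex.conj_eq_iff_im]
    exact (Complex.le_def.1 h1).2.symm
  rw [h2]
  have h3 := Complex.le_def.1 h1
  refine ⟨Complex.ext rfl h3.2, h3.1⟩

/-- For a positive trace class operator the sum defining the trace converges, over any Hilbert
basis, to the trace norm. -/
theorem hasSum_inner_of_isPositive {ι : Type*} (b : HilbertBasis ι ℂ H) {P : H →L[ℂ] H}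
    (hP : IsTraceClass P) (hpos : P.IsPositive) :
    HasSum (fun i => ⟪b i, P (b i)⟫_ℂ) (traceNorm P : ℂ) := by
  obtain ⟨Q, hQ, hQQ, hs, hn⟩ := hP.exists_sqrt
  rw [abs_eq_self_of_isPositive hpos] at hQQ
  have h := hasSum_of_hsSq_ne_top b hs
  rw [hn] at h
  have h1 := Complex.hasSum_ofReal.2 h
  have h2 : ∀ i, ⟪b i, P (b i)⟫_ℂ = ((‖Q (b i)‖ ^ 2 : ℝ) : ℂ) := by
    intro i
    rw [← hQQ, ContinuousLinearMap.comp_apply, ← ContinuousLinearMap.adjoint_inner_left, hQ,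
      inner_self_eq_norm_sq_to_K]
    simp
  simpa only [h2] using h1

theorem trace_of_isPositive {P : H →L[ℂ] H} (hP : IsTraceClass P) (hpos : P.IsPositive) :
    trace P = traceNorm P :=
  (hasSum_inner_of_isPositive _ hP hpos).tsum_eq

/-- The Jordan decomposition of a Hermitian trace class operator. -/
theorem exists_pos_sub_pos (X : TraceClass H) (hX : IsSelfAdjoint (X : H →L[ℂ] H)) :
    ∃ P N : TraceClass H, (P : H →L[ℂ] H).IsPositive ∧ (N : H →L[ℂ] H).IsPositive ∧
      X = P - N ∧
      traceNorm (P : H →L[ℂ] H) + traceNorm (N : H →L[ℂ] H) = traceNorm (X : H →L[ℂ] H) := by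
  let A : TraceClass H := ⟨CFC.abs (X : H →L[ℂ] H), isTraceClass_abs X.2⟩
  have h1 : ((A : H →L[ℂ] H) + X) = 2 • (X : H →L[ℂ] H)⁺ := CFC.abs_add_self _ hX
  have h2 : ((A : H →L[ℂ] H) - X) = 2 • (X : H →L[ℂ] H)⁻ := CFC.abs_sub_self _ hX
  have half : ∀ T : H →L[ℂ] H, (2⁻¹ : ℂ) • (2 • T) = T := fun T => by
    rw [two_nsmul, ← two_smul ℂ, smul_smul]; simp
  have hP : (((2⁻¹ : ℂ) • (A + X) : TraceClass H) : H →L[ℂ] H).IsPositive := by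
    rw [← ContinuousLinearMap.nonneg_iff_isPositive]
    simp only [Submodule.coe_smul, Submodule.coe_add]
    rw [h1, half]
    exact CFC.posPart_nonneg _
  have hN : (((2⁻¹ : ℂ) • (A - X) : TraceClass H) : H →L[ℂ] H).IsPositive := by
    rw [← ContinuousLinearMap.nonneg_iff_isPositive]
    simp only [Submodule.coe_smul, Submodule.coe_sub]
    rw [h2, half]
    exact CFC.negPart_nonneg _
  refine ⟨(2⁻¹ : ℂ) • (A + X), (2⁻¹ : ℂ) • (A - X), hP, hN, ?_, ?_⟩
  · module
  · have h3 := (hasSum_inner_of_isPositive (basis H) (Subtype.property _) hP).add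
      (hasSum_inner_of_isPositive (basis H) (Subtype.property _) hN)
    have h4 := hasSum_inner_of_isPositive (basis H) A.2 (abs_isPositive (X : H →L[ℂ] H))
    have h5 : ∀ i, ⟪basis H i, (((2⁻¹ : ℂ) • (A + X) : TraceClass H) : H →L[ℂ] H) (basis H i)⟫_ℂ
        + ⟪basis H i, (((2⁻¹ : ℂ) • (A - X) : TraceClass H) : H →L[ℂ] H) (basis H i)⟫_ℂ
        = ⟪basis H i, (A : H →L[ℂ] H) (basis H i)⟫_ℂ := by
      intro i
      rw [← inner_add_right, ← add_apply, ← Submodule.coe_add]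
      congr 4
      module
    simp_rw [h5] at h3
    have h6 := h3.unique h4
    rw [← traceNorm_abs (X : H →L[ℂ] H)]
    exact_mod_cast h6

/-- The adjoint of a trace class operator. -/
noncomputable def tcAdjoint (X : TraceClass H) : TraceClass H :=
  ⟨(X : H →L[ℂ] H).adjoint, IsTraceClass.adjoint X.2⟩

@[simp] theorem coe_tcAdjoint (X : TraceClass H) :
    (tcAdjoint X : H →L[ℂ] H) = (X : H →L[ℂ] H).adjoint := rfl

theorem tcAdjoint_of_isSelfAdjoint {X : TraceClass H} (hX : IsSelfAdjoint (X : H →L[ℂ] H)) :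
    tcAdjoint X = X :=
  Subtype.ext hX.adjoint_eq

theorem tcAdjoint_sub (X Y : TraceClass H) : tcAdjoint (X - Y) = tcAdjoint X - tcAdjoint Y :=
  Subtype.ext (map_sub _ _ _)

theorem tcAdjoint_add (X Y : TraceClass H) : tcAdjoint (X + Y) = tcAdjoint X + tcAdjoint Y :=
  Subtype.ext (map_add _ _ _)

/-- The decomposition of a trace class operator into its real and imaginary parts. -/
theorem exists_add_I_smul (X : TraceClass H) :
    ∃ R S : TraceClass H, IsSelfAdjoint (R : H →L[ℂ] H) ∧ IsSelfAdjoint (S : H →L[ℂ] H) ∧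
      X = R + Complex.I • S ∧
      traceNorm (R : H →L[ℂ] H) ≤ traceNorm (X : H →L[ℂ] H) ∧
      traceNorm (S : H →L[ℂ] H) ≤ traceNorm (X : H →L[ℂ] H) := by
  have key : ∀ c d : ℂ, ‖c‖ = 2⁻¹ → ‖d‖ = 2⁻¹ →
      traceNorm ((c • X + d • tcAdjoint X : TraceClass H) : H →L[ℂ] H) ≤
        traceNorm (X : H →L[ℂ] H) := by
    intro c d hc hd
    have h1 := traceNorm_add_le (c • X).2 (d • tcAdjoint X).2
    have h2 := traceNorm_smul_le c X.2
    have h3 := traceNorm_smul_le d (tcAdjoint X).2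
    have h4 := traceNorm_adjoint_le X.2
    rw [hc] at h2
    rw [hd] at h3
    simp only [Submodule.coe_smul, Submodule.coe_add, coe_tcAdjoint] at *
    linarith
  refine ⟨(2⁻¹ : ℂ) • X + (2⁻¹ : ℂ) • tcAdjoint X,
    (-Complex.I / 2) • X + (Complex.I / 2) • tcAdjoint X, ?_, ?_, ?_,
    key _ _ (by simp) (by simp), key _ _ (by simp) (by simp)⟩
  · rw [ContinuousLinearMap.isSelfAdjoint_iff']
    simp [map_smulₛₗ, add_comm, Complex.conj_ofNat]
  · rw [ContinuousLinearMap.isSelfAdjoint_iff']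
    simp [map_smulₛₗ, add_comm, Complex.conj_ofNat]
  · have hI : Complex.I * Complex.I = -1 := Complex.I_mul_I
    match_scalars
    · linear_combination (1/2) * hI
    · linear_combination (-1/2) * hI

/-- The sum defining the trace converges over any Hilbert basis, to the same value. -/
theorem hasSum_inner_trace {ι : Type*} (b : HilbertBasis ι ℂ H) (X : TraceClass H) :
    HasSum (fun i => ⟪b i, (X : H →L[ℂ] H) (b i)⟫_ℂ) (trace (X : H →L[ℂ] H)) := by
  obtain ⟨R, S, hR, hS, hX, -, -⟩ := exists_add_I_smul X
  obtain ⟨P₁, N₁, hP₁, hN₁, h₁, -⟩ := exists_pos_sub_pos R hR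
  obtain ⟨P₂, N₂, hP₂, hN₂, h₂, -⟩ := exists_pos_sub_pos S hS
  have h := ((hasSum_inner_of_isPositive b P₁.2 hP₁).sub
    (hasSum_inner_of_isPositive b N₁.2 hN₁)).add
    (((hasSum_inner_of_isPositive b P₂.2 hP₂).sub
    (hasSum_inner_of_isPositive b N₂.2 hN₂)).mul_left Complex.I)
  have h' := ((hasSum_inner_of_isPositive (basis H) P₁.2 hP₁).sub
    (hasSum_inner_of_isPositive (basis H) N₁.2 hN₁)).add
    (((hasSum_inner_of_isPositive (basis H) P₂.2 hP₂).sub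
    (hasSum_inner_of_isPositive (basis H) N₂.2 hN₂)).mul_left Complex.I)
  have e : ∀ x : H, ⟪x, (P₁ : H →L[ℂ] H) x⟫_ℂ - ⟪x, (N₁ : H →L[ℂ] H) x⟫_ℂ + Complex.I *
      (⟪x, (P₂ : H →L[ℂ] H) x⟫_ℂ - ⟪x, (N₂ : H →L[ℂ] H) x⟫_ℂ)
      = ⟪x, (X : H →L[ℂ] H) x⟫_ℂ := fun x => by
    rw [hX, h₁, h₂]
    simp
  simp only [e] at h h'
  rwa [trace, h'.tsum_eq]

theorem trace_add (X Y : TraceClass H) :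
    trace ((X + Y : TraceClass H) : H →L[ℂ] H)
      = trace (X : H →L[ℂ] H) + trace (Y : H →L[ℂ] H) := by
  refine (hasSum_inner_trace (basis H) (X + Y)).unique ?_
  simpa [inner_add_right] using
    (hasSum_inner_trace (basis H) X).add (hasSum_inner_trace (basis H) Y)

theorem trace_smul (c : ℂ) (X : TraceClass H) :
    trace ((c • X : TraceClass H) : H →L[ℂ] H) = c * trace (X : H →L[ℂ] H) := by
  refine (hasSum_inner_trace (basis H) (c • X)).unique ?_
  simpa [inner_smul_right] using (hasSum_inner_trace (basis H) X).mul_left c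

/-- The trace as a linear functional on the trace class operators. -/
noncomputable def traceLM : TraceClass H →ₗ[ℂ] ℂ where
  toFun X := trace (X : H →L[ℂ] H)
  map_add' := trace_add
  map_smul' := trace_smul

/-- A Hermitian operator whose trace is at least its trace norm is positive: the trace of its
negative part vanishes. -/
theorem isPositive_of_traceNorm_le_re_trace (X : TraceClass H)
    (hX : IsSelfAdjoint (X : H →L[ℂ] H))
    (h : traceNorm (X : H →L[ℂ] H) ≤ (trace (X : H →L[ℂ] H)).re) :
    (X : H →L[ℂ] H).IsPositive := by
  obtain ⟨P, N, hP, hN, rfl, hn⟩ := exists_pos_sub_pos X hX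
  have h1 : trace ((P - N : TraceClass H) : H →L[ℂ] H) = _ := map_sub traceLM P N
  have h2 : traceLM P = _ := trace_of_isPositive P.2 hP
  have h3 : traceLM N = _ := trace_of_isPositive N.2 hN
  rw [h1, h2, h3] at h
  simp only [Complex.sub_re, Complex.ofReal_re] at h
  have h4 : (N : H →L[ℂ] H) = 0 := eq_zero_of_traceNorm_le_zero N.2 (by linarith)
  rw [Submodule.coe_sub, h4, sub_zero]
  exact hP

/-! ### Linear maps that are contractive on positive operators -/

variable {K : Type*} [NormedAddCommGroup K] [InnerProductSpace ℂ K] [CompleteSpace K]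

theorem traceNorm_map_le_of_isSelfAdjoint {Φ : TraceClass H →ₗ[ℂ] TraceClass K}
    (hΦ : ∀ P : TraceClass H, (P : H →L[ℂ] H).IsPositive →
      traceNorm (Φ P : K →L[ℂ] K) ≤ traceNorm (P : H →L[ℂ] H))
    (X : TraceClass H) (hX : IsSelfAdjoint (X : H →L[ℂ] H)) :
    traceNorm (Φ X : K →L[ℂ] K) ≤ traceNorm (X : H →L[ℂ] H) := by
  obtain ⟨P, N, hP, hN, h, hn⟩ := exists_pos_sub_pos X hX
  rw [← hn, h, map_sub]
  exact (traceNorm_sub_le (Φ P).2 (Φ N).2).trans (add_le_add (hΦ P hP) (hΦ N hN))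

theorem traceNorm_map_le_two_mul {Φ : TraceClass H →ₗ[ℂ] TraceClass K}
    (hΦ : ∀ P : TraceClass H, (P : H →L[ℂ] H).IsPositive →
      traceNorm (Φ P : K →L[ℂ] K) ≤ traceNorm (P : H →L[ℂ] H))
    (X : TraceClass H) :
    traceNorm (Φ X : K →L[ℂ] K) ≤ 2 * traceNorm (X : H →L[ℂ] H) := by
  obtain ⟨R, S, hR, hS, h, hR', hS'⟩ := exists_add_I_smul X
  have h1 := traceNorm_map_le_of_isSelfAdjoint hΦ R hR
  have h2 := traceNorm_map_le_of_isSelfAdjoint hΦ S hS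
  have h3 := traceNorm_add_le (Φ R).2 (Complex.I • Φ S).2
  have h4 := traceNorm_smul_le Complex.I (Φ S).2
  have h5 : Φ X = Φ R + Complex.I • Φ S := by rw [h, map_add, map_smul]
  rw [h5]
  simp only [Submodule.coe_smul, Submodule.coe_add, Complex.norm_I] at *
  linarith

theorem traceNorm_map_of_isPositive {Φ : TraceClass H →ₗ[ℂ] TraceClass H}
    (hΦ : IsPositiveMap Φ) (hT : IsTracePreserving Φ) (P : TraceClass H)
    (hP : (P : H →L[ℂ] H).IsPositive) :
    traceNorm (Φ P : H →L[ℂ] H) = traceNorm (P : H →L[ℂ] H) := by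
  have h := hT P
  rw [trace_of_isPositive P.2 hP, trace_of_isPositive (Φ P).2 (hΦ P hP)] at h
  exact_mod_cast h

theorem IsCompletelyPositive.isPositiveMap {Φ : TraceClass H →ₗ[ℂ] TraceClass H}
    (hΦ : IsCompletelyPositive Φ) : IsPositiveMap Φ := by
  intro X hX
  refine isPositive_of_inner_nonneg fun x => ?_
  have h := hΦ 1 (fun _ _ => X) (fun y => by simpa using hX.inner_nonneg_right (y 0)) fun _ => x
  simpa using h

theorem IsPositiveMap.map_tcAdjoint {Φ : TraceClass H →ₗ[ℂ] TraceClass H}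
    (hΦ : IsPositiveMap Φ) (X : TraceClass H) : Φ (tcAdjoint X) = tcAdjoint (Φ X) := by
  have key : ∀ R : TraceClass H, IsSelfAdjoint (R : H →L[ℂ] H) →
      tcAdjoint (Φ R) = Φ R := by
    intro R hR
    obtain ⟨P, N, hP, hN, h, -⟩ := exists_pos_sub_pos R hR
    rw [h, map_sub, tcAdjoint_sub, tcAdjoint_of_isSelfAdjoint (hΦ P hP).isSelfAdjoint,
      tcAdjoint_of_isSelfAdjoint (hΦ N hN).isSelfAdjoint]
  have hI : ∀ R : TraceClass H, tcAdjoint (Complex.I • R) = (-Complex.I) • tcAdjoint R :=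
    fun R => Subtype.ext (by simp [map_smulₛₗ])
  obtain ⟨R, S, hR, hS, h, -, -⟩ := exists_add_I_smul X
  rw [h, map_add, map_smul, tcAdjoint_add, tcAdjoint_add, hI, hI, map_add, map_smul, key R hR,
    key S hS, tcAdjoint_of_isSelfAdjoint hR, tcAdjoint_of_isSelfAdjoint hS]

end Trace

/-! ### Matrix units, slices and blocks of operators on the tensor square -/

section Slices

open InnerProductSpace (rankOne)

section

variable {H : Type*} [NormedAddCommGroup H] [InnerProductSpace ℂ H]

theorem add_vtmul (x y z : H) : vtmul (x + y) z = vtmul x z + vtmul y z := by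
  rw [vtmul, TensorProduct.add_tmul, UniformSpace.Completion.coe_add]; rfl

theorem vtmul_add (x y z : H) : vtmul x (y + z) = vtmul x y + vtmul x z := by
  rw [vtmul, TensorProduct.tmul_add, UniformSpace.Completion.coe_add]; rfl

theorem smul_vtmul (c : ℂ) (x y : H) : vtmul (c • x) y = c • vtmul x y := by
  rw [vtmul, ← TensorProduct.smul_tmul', UniformSpace.Completion.coe_smul]; rfl

theorem vtmul_smul (c : ℂ) (x y : H) : vtmul x (c • y) = c • vtmul x y := by
  simp [vtmul]

/-- The operator `x ↦ e ⊗ x` from `H` to `H ⊗ H`. -/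
noncomputable def vtmulL (e : H) : H →L[ℂ] HilbertTensor H :=
  UniformSpace.Completion.toComplL ∘L TensorProduct.mkL ℂ H H e

theorem vtmulL_apply (e x : H) : vtmulL e x = vtmul e x := rfl

end

variable {H : Type*} [NormedAddCommGroup H] [InnerProductSpace ℂ H] [CompleteSpace H]

theorem vtmulL_adjoint_vtmul (e x y : H) : (vtmulL e).adjoint (vtmul x y) = ⟪e, x⟫_ℂ • y := by
  refine ext_inner_left ℂ fun z => ?_
  rw [ContinuousLinearMap.adjoint_inner_right, vtmulL_apply, inner_vtmul, inner_smul_right]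

theorem optmul_rankOne (u v : H) (A : H →L[ℂ] H) :
    optmul (rankOne ℂ u v) A = vtmulL u ∘L A ∘L (vtmulL v).adjoint := by
  refine operator_ext fun x y => ?_
  simp only [optmul_vtmul, ContinuousLinearMap.comp_apply, vtmulL_adjoint_vtmul, map_smul,
    vtmulL_apply, InnerProductSpace.rankOne_apply]
  rw [smul_vtmul]

theorem rankOne_vtmul (a b c d : H) :
    rankOne ℂ (vtmul a b) (vtmul c d) = optmul (rankOne ℂ a c) (rankOne ℂ b d) := by
  rw [optmul_rankOne]
  refine operator_ext fun x y => ?_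
  simp [inner_vtmul, vtmulL_adjoint_vtmul, vtmulL_apply, smul_smul]

variable {E : Type*} [NormedAddCommGroup E] [InnerProductSpace ℂ E] [CompleteSpace E]

theorem isTraceClass_rankOne (x y : E) : IsTraceClass (rankOne ℂ x y) := by
  refine (isTraceClass_iff _).2 fun W => ?_
  have h := tsum_enorm_inner_ne_top (H := ℂ) (fun i => ⟪basis E i, y⟫_ℂ)
    (fun i => ⟪basis E i, W x⟫_ℂ) (by rw [hilbertBasis_tsum_enorm_sq]; finiteness)
    (by rw [hilbertBasis_tsum_enorm_sq]; finiteness)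
  convert h using 5 with i
  simp [mul_comm]

/-- The rank one operator `|x⟩⟨y|` as a trace class operator. -/
noncomputable def tcRankOne (x y : E) : TraceClass E := ⟨rankOne ℂ x y, isTraceClass_rankOne x y⟩

@[simp] theorem coe_tcRankOne (x y : E) : (tcRankOne x y : E →L[ℂ] E) = rankOne ℂ x y := rfl

theorem trace_tcRankOne (x y : E) : trace (tcRankOne x y : E →L[ℂ] E) = ⟪y, x⟫_ℂ := by
  have h := (basis E).hasSum_inner_mul_inner y x
  rw [trace, ← h.tsum_eq]
  exact tsum_congr fun i => by simp

theorem isTraceClass_compress {Y : E →L[ℂ] E} (hY : IsTraceClass Y) (J₁ J₂ : H →L[ℂ] E) :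
    IsTraceClass (J₁.adjoint ∘L Y ∘L J₂) := by
  obtain ⟨A, B, rfl, hA, hB, -, -⟩ := hY.exists_factor_le
  have key : ∀ (D : E →L[ℂ] E) (J : H →L[ℂ] E), hsSq D ≠ ⊤ →
      ∑' i, ‖(D ∘L J) (basis H i)‖ₑ ^ 2 ≠ ⊤ := by
    intro D J hD
    rw [tsum_enorm_sq_adjoint (basis H) (basis E)]
    refine ne_top_of_le_ne_top (b := ‖J.adjoint‖ₑ ^ 2 * hsSq D.adjoint)
      (ENNReal.mul_ne_top (by finiteness) (by rwa [hsSq_adjoint])) ?_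
    rw [hsSq, ← ENNReal.tsum_mul_left]
    refine ENNReal.tsum_le_tsum fun i => ?_
    rw [← mul_pow, ContinuousLinearMap.adjoint_comp]
    gcongr
    exact J.adjoint.le_opENorm _
  refine (isTraceClass_iff _).2 fun W => ?_
  have h : ∀ i, ⟪basis H i, (W ∘L J₁.adjoint ∘L (A.adjoint ∘L B) ∘L J₂) (basis H i)⟫_ℂ
      = ⟪(A ∘L (J₁ ∘L W.adjoint)) (basis H i), (B ∘L J₂) (basis H i)⟫_ℂ := fun i => by
    simp only [ContinuousLinearMap.comp_apply]
    rw [← ContinuousLinearMap.adjoint_inner_left, ← ContinuousLinearMap.adjoint_inner_left,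
      ← ContinuousLinearMap.adjoint_inner_left]
    simp only [ContinuousLinearMap.adjoint_adjoint]
  simp_rw [h]
  exact tsum_enorm_inner_ne_top _ _ (key A (J₁ ∘L W.adjoint) hA) (key B J₂ hB)

/-- The map `Y ↦ J₁* Y J₂` on trace class operators. -/
noncomputable def compress (J₁ J₂ : H →L[ℂ] E) : TraceClass E →ₗ[ℂ] TraceClass H where
  toFun Y := ⟨J₁.adjoint ∘L (Y : E →L[ℂ] E) ∘L J₂, isTraceClass_compress Y.2 J₁ J₂⟩
  map_add' X Y := Subtype.ext (by ext; simp)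
  map_smul' c X := Subtype.ext (by ext; simp)

theorem coe_compress (J₁ J₂ : H →L[ℂ] E) (Y : TraceClass E) :
    (compress J₁ J₂ Y : H →L[ℂ] H) = J₁.adjoint ∘L (Y : E →L[ℂ] E) ∘L J₂ := rfl

theorem compress_vtmulL_tctmul (e f : H) (A B : TraceClass H) :
    compress (vtmulL e) (vtmulL f) (tctmul A B) = ⟪e, (A : H →L[ℂ] H) f⟫_ℂ • B := by
  refine Subtype.ext (ContinuousLinearMap.ext fun x => ?_)
  simp [coe_compress, tctmul, vtmulL_apply, optmul_vtmul, vtmulL_adjoint_vtmul]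

/-- The tensor product of trace class operators as a bilinear map. -/
noncomputable def tctmulL :
    TraceClass H →ₗ[ℂ] TraceClass H →ₗ[ℂ] TraceClass (HilbertTensor H) :=
  LinearMap.mk₂ ℂ tctmul
    (fun A A' B => Subtype.ext (operator_ext fun x y => by
      simp [tctmul, optmul_vtmul, add_vtmul]))
    (fun c A B => Subtype.ext (operator_ext fun x y => by
      simp [tctmul, optmul_vtmul, smul_vtmul]))
    (fun A B B' => Subtype.ext (operator_ext fun x y => by
      simp [tctmul, optmul_vtmul, vtmul_add]))
    (fun c A B => Subtype.ext (operator_ext fun x y => by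
      simp [tctmul, optmul_vtmul, vtmul_smul]))

@[simp] theorem tctmulL_apply (A B : TraceClass H) : tctmulL A B = tctmul A B := rfl

theorem coe_tctmul_tcRankOne (u v : H) (A : TraceClass H) :
    (tctmul (tcRankOne u v) A : HilbertTensor H →L[ℂ] HilbertTensor H)
      = vtmulL u ∘L (A : H →L[ℂ] H) ∘L (vtmulL v).adjoint :=
  optmul_rankOne u v A

theorem inner_vtmul_tctmul (A B : TraceClass H) (x y z w : H) :
    ⟪vtmul x y, (tctmul A B : HilbertTensor H →L[ℂ] HilbertTensor H) (vtmul z w)⟫_ℂ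
      = ⟪x, (A : H →L[ℂ] H) z⟫_ℂ * ⟪y, (B : H →L[ℂ] H) w⟫_ℂ := by
  rw [← inner_vtmul, ← optmul_vtmul]; rfl

theorem eq_mul_of_hasSum_prod {ι κ : Type*} {f : ι → ℂ} {g : κ → ℂ} {a b c : ℂ}
    (h : HasSum (fun p : ι × κ => f p.1 * g p.2) c) (hf : HasSum f a) (hg : HasSum g b) :
    c = a * b :=
  (h.prod_fiberwise fun i => hg.mul_left (f i)).unique (hf.mul_right b)

theorem trace_tctmul (A B : TraceClass H) :
    trace (tctmul A B : HilbertTensor H →L[ℂ] HilbertTensor H)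
      = trace (A : H →L[ℂ] H) * trace (B : H →L[ℂ] H) := by
  obtain ⟨b, hb⟩ := exists_tensor_hilbertBasis H
  have h := hasSum_inner_trace b (tctmul A B)
  simp only [hb, inner_vtmul_tctmul] at h
  exact eq_mul_of_hasSum_prod
    (f := fun i => ⟪basis H i, (A : H →L[ℂ] H) (basis H i)⟫_ℂ)
    (g := fun i => ⟪basis H i, (B : H →L[ℂ] H) (basis H i)⟫_ℂ) h
    (hasSum_inner_trace (basis H) A) (hasSum_inner_trace (basis H) B)

section Block

variable {ι : Type*} [Fintype ι]

/-- The trace class operator `∑ |uᵢ⟩⟨uⱼ| ⊗ Tᵢⱼ` on `H ⊗ H`. -/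
noncomputable def blockOp (u : ι → H) (T : ι → ι → TraceClass H) :
    TraceClass (HilbertTensor H) :=
  ∑ i, ∑ j, tctmul (tcRankOne (u i) (u j)) (T i j)

theorem inner_blockOp (u : ι → H) (T : ι → ι → TraceClass H) (x y : HilbertTensor H) :
    ⟪x, (blockOp u T : HilbertTensor H →L[ℂ] HilbertTensor H) y⟫_ℂ
      = ∑ i, ∑ j, ⟪(vtmulL (u i)).adjoint x,
          (T i j : H →L[ℂ] H) ((vtmulL (u j)).adjoint y)⟫_ℂ := by
  simp only [blockOp, Submodule.coe_sum, coe_tctmul_tcRankOne, sum_apply,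
    inner_sum, ContinuousLinearMap.comp_apply, ContinuousLinearMap.adjoint_inner_left]

theorem blockOp_isPositive (u : ι → H) {T : ι → ι → TraceClass H}
    (hT : ∀ x : ι → H, 0 ≤ ∑ i, ∑ j, ⟪x i, (T i j : H →L[ℂ] H) (x j)⟫_ℂ) :
    (blockOp u T : HilbertTensor H →L[ℂ] HilbertTensor H).IsPositive :=
  isPositive_of_inner_nonneg fun x => by
    rw [inner_blockOp]
    exact hT fun i => (vtmulL (u i)).adjoint x

theorem trace_blockOp {u : ι → H} (hu : Orthonormal ℂ u) (T : ι → ι → TraceClass H) :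
    trace (blockOp u T : HilbertTensor H →L[ℂ] HilbertTensor H)
      = ∑ i, trace (T i i : H →L[ℂ] H) := by
  classical
  change traceLM (blockOp u T) = _
  simp only [blockOp, map_sum]
  refine Finset.sum_congr rfl fun i _ => ?_
  have : ∀ j, traceLM (tctmul (tcRankOne (u i) (u j)) (T i j))
      = if j = i then trace (T i j : H →L[ℂ] H) else 0 := fun j => by
    change trace _ = _
    rw [trace_tctmul, trace_tcRankOne, orthonormal_iff_ite.1 hu]
    split_ifs <;> simp
  simp [this]

/-- Complete positivity for matrices indexed by an arbitrary finite type. -/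
theorem IsCompletelyPositive.inner_nonneg {Φ : TraceClass H →ₗ[ℂ] TraceClass H}
    (hΦ : IsCompletelyPositive Φ) {T : ι → ι → TraceClass H}
    (hT : ∀ x : ι → H, 0 ≤ ∑ i, ∑ j, ⟪x i, (T i j : H →L[ℂ] H) (x j)⟫_ℂ) (x : ι → H) :
    0 ≤ ∑ i, ∑ j, ⟪x i, (Φ (T i j) : H →L[ℂ] H) (x j)⟫_ℂ := by
  let e := (Fintype.equivFin ι).symm
  have h := hΦ (Fintype.card ι) (fun i j => T (e i) (e j)) (fun y => by
    have := hT (y ∘ e.symm)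
    rw [← e.sum_comp] at this
    simp_rw [← e.sum_comp (fun j => ⟪(y ∘ e.symm) _, (T _ j : H →L[ℂ] H) _⟫_ℂ)] at this
    simpa using this) (x ∘ e)
  rw [← e.sum_comp]
  simp_rw [← e.sum_comp (fun j => ⟪x _, (Φ (T _ j) : H →L[ℂ] H) (x j)⟫_ℂ)]
  exact h

end Block

end Slices

/-! ### Weak limits of operators bounded in trace norm -/

section WeakLimit

open Filter Topology

variable {E : Type*} [NormedAddCommGroup E] [InnerProductSpace ℂ E] [CompleteSpace E]

/-- A bounded family of operators converges in the weak operator topology along every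
ultrafilter. -/
theorem exists_weak_limit {α : Type*} (l : Ultrafilter α) (T : α → E →L[ℂ] E) (C : ℝ)
    (hT : ∀ a, ‖T a‖ ≤ C) :
    ∃ S : E →L[ℂ] E, ∀ x y, Tendsto (fun a => ⟪x, T a y⟫_ℂ) l (𝓝 ⟪x, S y⟫_ℂ) := by
  have hb : ∀ x y a, ‖⟪T a x, y⟫_ℂ‖ ≤ C * ‖x‖ * ‖y‖ := fun x y a =>
    (norm_inner_le_norm _ _).trans (by gcongr; exact (T a).le_of_opNorm_le (hT a) x)
  have hlim : ∀ x y, ∃ z : ℂ, Tendsto (fun a => ⟪T a x, y⟫_ℂ) l (𝓝 z) := by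
    intro x y
    obtain ⟨z, -, hz⟩ := (isCompact_closedBall (0 : ℂ) (C * ‖x‖ * ‖y‖)).ultrafilter_le_nhds
      (l.map fun a => ⟪T a x, y⟫_ℂ) (by
        rw [le_principal_iff, Ultrafilter.mem_coe, Ultrafilter.mem_map]
        exact Filter.univ_mem' fun a => by simpa using hb x y a)
    exact ⟨z, hz⟩
  choose B hB using hlim
  let B' : E →L⋆[ℂ] E →L[ℂ] ℂ := LinearMap.mkContinuous₂
    (LinearMap.mk₂'ₛₗ (starRingEnd ℂ) (RingHom.id ℂ) B
      (fun x x' y => tendsto_nhds_unique (hB _ y) (by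
        simpa [inner_add_left] using (hB x y).add (hB x' y)))
      (fun c x y => tendsto_nhds_unique (hB _ y) (by
        simpa [inner_smul_left, mul_comm] using (hB x y).const_mul (starRingEnd ℂ c)))
      (fun x y y' => tendsto_nhds_unique (hB x _) (by
        simpa [inner_add_right] using (hB x y).add (hB x y')))
      (fun c x y => tendsto_nhds_unique (hB x _) (by
        simpa [inner_smul_right] using (hB x y).const_mul c))) C fun x y =>
      le_of_tendsto (hB x y).norm (Eventually.of_forall (hb x y))
  refine ⟨InnerProductSpace.continuousLinearMapOfBilin B', fun x y => ?_⟩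
  have h1 : ⟪InnerProductSpace.continuousLinearMapOfBilin B' y, x⟫_ℂ = B y x :=
    InnerProductSpace.continuousLinearMapOfBilin_apply B' y x
  have h2 := (Complex.continuous_conj.tendsto _).comp (hB y x)
  rw [← h1] at h2
  simpa only [Function.comp_def, inner_conj_symm] using h2

theorem isTraceClass_and_traceNorm_le_of_weak_limit {α : Type*} {l : Filter α} [l.NeBot]
    {T : α → TraceClass E} {S : E →L[ℂ] E} {C : ℝ}
    (hT : ∀ a, traceNorm (T a : E →L[ℂ] E) ≤ C)
    (h : ∀ x y, Tendsto (fun a => ⟪x, (T a : E →L[ℂ] E) y⟫_ℂ) l (𝓝 ⟪x, S y⟫_ℂ)) :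
    IsTraceClass S ∧ traceNorm S ≤ C := by
  refine traceNorm_le_of_forall_contraction fun W hW F => ?_
  refine le_of_tendsto (x := l)
    (f := fun a => ‖∑ i ∈ F, ⟪basis E i, W ((T a : E →L[ℂ] E) (basis E i))⟫_ℂ‖) ?_
    (Eventually.of_forall fun a => (norm_sum_inner_comp_le (T a).2 hW _ F).trans (hT a))
  refine (tendsto_finsetSum _ fun i _ => ?_).norm
  simpa only [ContinuousLinearMap.adjoint_inner_left] using
    h (W.adjoint (basis E i)) (basis E i)

end WeakLimit

/-! ### Existence of the ampliation -/

section Existence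

open Filter Topology

variable {H : Type*} [NormedAddCommGroup H] [InnerProductSpace ℂ H] [CompleteSpace H]

/-- The `(i, j)` block of an operator on `H ⊗ H`, relative to the fixed basis of the first
factor. -/
noncomputable def block (i j : basisIndex H) :
    TraceClass (HilbertTensor H) →ₗ[ℂ] TraceClass H :=
  compress (vtmulL (basis H i)) (vtmulL (basis H j))

/-- The map `Y ↦ ∑ |eᵢ⟩⟨eⱼ| ⊗ Φ(Yᵢⱼ)`, over the indices in a finite set `F`: the ampliation of `Φ`
applied to the corner of `Y` given by `F`. -/
noncomputable def cornerAmpliation (Φ : TraceClass H →ₗ[ℂ] TraceClass H)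
    (F : Finset (basisIndex H)) :
    TraceClass (HilbertTensor H) →ₗ[ℂ] TraceClass (HilbertTensor H) :=
  ∑ i : F, ∑ j : F, tctmulL (tcRankOne (basis H i) (basis H j)) ∘ₗ Φ ∘ₗ block i.1 j.1

theorem cornerAmpliation_apply (Φ : TraceClass H →ₗ[ℂ] TraceClass H)
    (F : Finset (basisIndex H)) (Y : TraceClass (HilbertTensor H)) :
    cornerAmpliation Φ F Y
      = blockOp (fun i : F => basis H i) fun i j => Φ (block i.1 j.1 Y) := by
  simp [cornerAmpliation, blockOp, LinearMap.sum_apply]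

theorem sum_trace_block_le (F : Finset (basisIndex H)) {Y : TraceClass (HilbertTensor H)}
    (hY : (Y : HilbertTensor H →L[ℂ] HilbertTensor H).IsPositive) :
    (∑ i : F, trace (block i.1 i.1 Y : H →L[ℂ] H)).re
      ≤ traceNorm (Y : HilbertTensor H →L[ℂ] HilbertTensor H) := by
  obtain ⟨b, hb⟩ := exists_tensor_hilbertBasis H
  have h := hasSum_inner_of_isPositive b Y.2 hY
  have h1 : ∀ i, HasSum
      (fun j => ⟪b (i, j), (Y : HilbertTensor H →L[ℂ] HilbertTensor H) (b (i, j))⟫_ℂ)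
      (trace (block i i Y : H →L[ℂ] H)) := by
    intro i
    have h2 := hasSum_inner_trace (basis H) (block i i Y)
    refine h2.congr_fun fun j => ?_
    simp [block, coe_compress, ContinuousLinearMap.adjoint_inner_right, vtmulL_apply, hb]
  have h3 := Complex.hasSum_re (h.prod_fiberwise h1)
  rw [Complex.ofReal_re] at h3
  rw [Complex.re_sum, Finset.sum_coe_sort F fun i => (trace (block i i Y : H →L[ℂ] H)).re]
  refine sum_le_hasSum F (fun i _ => ?_) h3
  exact (Complex.hasSum_re (h1 i)).nonneg fun j => hY.re_inner_nonneg_right _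

theorem sum_inner_block_nonneg (F : Finset (basisIndex H)) {Y : TraceClass (HilbertTensor H)}
    (hY : (Y : HilbertTensor H →L[ℂ] HilbertTensor H).IsPositive) (x : F → H) :
    0 ≤ ∑ i, ∑ j, ⟪x i, (block i.1 j.1 Y : H →L[ℂ] H) (x j)⟫_ℂ := by
  have h := hY.inner_nonneg_right (∑ i : F, vtmul (basis H i) (x i))
  rw [map_sum, sum_inner] at h
  simp_rw [inner_sum] at h
  simpa [block, coe_compress, ContinuousLinearMap.adjoint_inner_right, vtmulL_apply] using h

theorem isPositiveMap_cornerAmpliation {Φ : TraceClass H →ₗ[ℂ] TraceClass H}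
    (hΦ : IsCompletelyPositive Φ) (F : Finset (basisIndex H)) :
    IsPositiveMap (cornerAmpliation Φ F) := fun Y hY => by
  rw [cornerAmpliation_apply]
  exact blockOp_isPositive _ (hΦ.inner_nonneg (sum_inner_block_nonneg F hY))

theorem traceNorm_cornerAmpliation_le {Φ : TraceClass H →ₗ[ℂ] TraceClass H}
    (hΦ : IsCompletelyPositive Φ) (hT : IsTracePreserving Φ) (F : Finset (basisIndex H))
    (Y : TraceClass (HilbertTensor H))
    (hY : (Y : HilbertTensor H →L[ℂ] HilbertTensor H).IsPositive) :
    traceNorm (cornerAmpliation Φ F Y : HilbertTensor H →L[ℂ] HilbertTensor H)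
      ≤ traceNorm (Y : HilbertTensor H →L[ℂ] HilbertTensor H) := by
  have h1 := trace_of_isPositive (Subtype.property _) (isPositiveMap_cornerAmpliation hΦ F Y hY)
  rw [cornerAmpliation_apply, trace_blockOp (u := fun i : F => basis H i)
    ((basis H).orthonormal.comp _ Subtype.val_injective)] at h1
  simp_rw [hT _] at h1
  rw [cornerAmpliation_apply]
  have h2 := sum_trace_block_le F hY
  rw [h1, Complex.ofReal_re] at h2
  exact h2

theorem tendsto_inner_cornerAmpliation_tctmul (Φ : TraceClass H →ₗ[ℂ] TraceClass H)
    (A B : TraceClass H) (x₁ x₂ y₁ y₂ : H) :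
    Tendsto (fun F => ⟪vtmul x₁ x₂,
      (cornerAmpliation Φ F (tctmul A B) : HilbertTensor H →L[ℂ] HilbertTensor H)
        (vtmul y₁ y₂)⟫_ℂ) atTop
      (𝓝 ⟪vtmul x₁ x₂, (tctmul A (Φ B) : HilbertTensor H →L[ℂ] HilbertTensor H)
        (vtmul y₁ y₂)⟫_ℂ) := by
  have hx : ∀ x : H, Tendsto (fun F : Finset (basisIndex H) =>
      ∑ i ∈ F, ⟪basis H i, x⟫_ℂ • basis H i) atTop (𝓝 x) := fun x => by
    simpa only [HasSum, SummationFilter.unconditional_filter, HilbertBasis.repr_apply_apply]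
      using (basis H).hasSum_repr x
  have h1 := ((hx x₁).inner (((A : H →L[ℂ] H).continuous.tendsto _).comp (hx y₁))).mul_const
    ⟪x₂, (Φ B : H →L[ℂ] H) y₂⟫_ℂ
  rw [inner_vtmul_tctmul]
  refine h1.congr fun F => ?_
  rw [cornerAmpliation_apply, inner_blockOp]
  simp only [block, compress_vtmulL_tctmul, vtmulL_adjoint_vtmul, map_smul, Submodule.coe_smul,
    smul_apply, inner_smul_left, inner_smul_right, Function.comp_apply, map_sum, sum_inner,
    inner_sum, Finset.sum_mul, Finset.mul_sum, ← Finset.sum_coe_sort F]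
  rw [Finset.sum_comm]
  refine Finset.sum_congr rfl fun i _ => Finset.sum_congr rfl fun j _ => ?_
  ring

/-- A completely positive, trace preserving map has a bounded ampliation, which is positive and does
not increase the trace norm of positive operators. It is a weak limit of the ampliations on finite
corners. -/
theorem exists_isIdTensor {Φ : TraceClass H →ₗ[ℂ] TraceClass H}
    (hΦ : IsCompletelyPositive Φ) (hT : IsTracePreserving Φ) :
    ∃ Ψ, IsIdTensor Φ Ψ ∧ IsPositiveMap Ψ ∧ ∀ Y : TraceClass (HilbertTensor H),
      (Y : HilbertTensor H →L[ℂ] HilbertTensor H).IsPositive →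
      traceNorm (Ψ Y : HilbertTensor H →L[ℂ] HilbertTensor H)
        ≤ traceNorm (Y : HilbertTensor H →L[ℂ] HilbertTensor H) := by
  let l : Ultrafilter (Finset (basisIndex H)) := Ultrafilter.of atTop
  have hpos := fun F => traceNorm_cornerAmpliation_le hΦ hT F
  have hlim : ∀ Y : TraceClass (HilbertTensor H), ∃ S : TraceClass (HilbertTensor H),
      ∀ x y, Tendsto (fun F => ⟪x, (cornerAmpliation Φ F Y :
        HilbertTensor H →L[ℂ] HilbertTensor H) y⟫_ℂ) l
        (𝓝 ⟪x, (S : HilbertTensor H →L[ℂ] HilbertTensor H) y⟫_ℂ) := by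
    intro Y
    have hb := fun F => traceNorm_map_le_two_mul (hpos F) Y
    obtain ⟨S, hS⟩ := exists_weak_limit l
      (fun F => (cornerAmpliation Φ F Y : HilbertTensor H →L[ℂ] HilbertTensor H)) _
      fun F => (norm_le_traceNorm (Subtype.property _)).trans (hb F)
    exact ⟨⟨S, (isTraceClass_and_traceNorm_le_of_weak_limit hb hS).1⟩, hS⟩
  choose Ψ hΨ using hlim
  have huniq : ∀ {Y S : TraceClass (HilbertTensor H)}, (∀ x y, Tendsto
      (fun F => ⟪x, (cornerAmpliation Φ F Y : HilbertTensor H →L[ℂ] HilbertTensor H) y⟫_ℂ) l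
        (𝓝 ⟪x, (S : HilbertTensor H →L[ℂ] HilbertTensor H) y⟫_ℂ)) → Ψ Y = S := by
    intro Y S h
    refine Subtype.ext (ContinuousLinearMap.ext fun y => ext_inner_left ℂ fun x => ?_)
    exact tendsto_nhds_unique (hΨ Y x y) (h x y)
  let Ψ' : TraceClass (HilbertTensor H) →ₗ[ℂ] TraceClass (HilbertTensor H) :=
    { toFun := Ψ
      map_add' := fun Y Z => huniq fun x y => by
        simpa [inner_add_right] using (hΨ Y x y).add (hΨ Z x y)
      map_smul' := fun c Y => huniq fun x y => by
        simpa [inner_smul_right] using (hΨ Y x y).const_mul c }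
  have hle : ∀ Y : TraceClass (HilbertTensor H),
      (Y : HilbertTensor H →L[ℂ] HilbertTensor H).IsPositive →
      traceNorm (Ψ' Y : HilbertTensor H →L[ℂ] HilbertTensor H)
        ≤ traceNorm (Y : HilbertTensor H →L[ℂ] HilbertTensor H) := fun Y hY =>
    (isTraceClass_and_traceNorm_le_of_weak_limit (fun F => hpos F Y hY) (hΨ Y)).2
  refine ⟨Ψ', ⟨⟨2, traceNorm_map_le_two_mul hle⟩, fun A B => ?_⟩, fun Y hY => ?_, hle⟩
  swap
  · refine isPositive_of_inner_nonneg fun x => ge_of_tendsto' (hΨ Y x x) fun F => ?_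
    exact (isPositiveMap_cornerAmpliation hΦ F Y hY).inner_nonneg_right x
  refine Subtype.ext (operator_ext fun y₁ y₂ => eq_of_inner_vtmul fun x₁ x₂ => ?_)
  have h := tendsto_nhds_unique (hΨ (tctmul A B) _ _)
    ((tendsto_inner_cornerAmpliation_tctmul Φ A B x₁ x₂ y₁ y₂).mono_left
      (Ultrafilter.of_le atTop))
  have h' := congrArg (starRingEnd ℂ) h
  simp only [inner_conj_symm] at h'
  exact h'

end Existence

/-! ### Uniqueness of the ampliation -/

section Uniqueness

open Filter Topology

open InnerProductSpace (rankOne)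

variable {E : Type*} [NormedAddCommGroup E] [InnerProductSpace ℂ E]

/-- The orthogonal projection onto the span of finitely many vectors of a Hilbert basis. -/
noncomputable def basisProj {ι : Type*} (b : HilbertBasis ι ℂ E) (F : Finset ι) : E →L[ℂ] E :=
  ∑ i ∈ F, rankOne ℂ (b i) (b i)

theorem basisProj_apply_basis {ι : Type*} [DecidableEq ι] (b : HilbertBasis ι ℂ E)
    (F : Finset ι) (i : ι) :
    basisProj b F (b i) = if i ∈ F then b i else 0 := by
  simp [basisProj, sum_apply, orthonormal_iff_ite.1 b.orthonormal]

theorem basisProj_comp_comp_basisProj {ι : Type*} (b : HilbertBasis ι ℂ E) (Y : E →L[ℂ] E)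
    (F : Finset ι) : basisProj b F ∘L Y ∘L basisProj b F
      = ∑ i ∈ F, ∑ j ∈ F, ⟪b i, Y (b j)⟫_ℂ • rankOne ℂ (b i) (b j) := by
  ext x
  simp only [basisProj, ContinuousLinearMap.comp_apply, sum_apply, map_sum,
    InnerProductSpace.rankOne_apply, map_smul, smul_apply, smul_smul, Finset.smul_sum]
  rw [Finset.sum_comm]
  refine Finset.sum_congr rfl fun i _ => Finset.sum_congr rfl fun j _ => ?_
  rw [mul_comm]

variable [CompleteSpace E]

theorem adjoint_basisProj {ι : Type*} (b : HilbertBasis ι ℂ E) (F : Finset ι) :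
    (basisProj b F).adjoint = basisProj b F := by
  simp [basisProj, map_sum]

theorem hsSq_comp_basisProj_le {ι : Type*} (b : HilbertBasis ι ℂ E) (A : E →L[ℂ] E)
    (F : Finset ι) : hsSq (A ∘L basisProj b F) ≤ hsSq A := by
  classical
  rw [← tsum_enorm_sq_eq_hsSq b, ← tsum_enorm_sq_eq_hsSq b]
  refine ENNReal.tsum_le_tsum fun i => ?_
  rw [ContinuousLinearMap.comp_apply, basisProj_apply_basis]
  split_ifs <;> simp

theorem hsSq_sub_comp_basisProj_le {ι : Type*} (b : HilbertBasis ι ℂ E) (A : E →L[ℂ] E)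
    (F : Finset ι) : hsSq (A - A ∘L basisProj b F) ≤ hsSq A := by
  classical
  rw [← tsum_enorm_sq_eq_hsSq b, ← tsum_enorm_sq_eq_hsSq b]
  refine ENNReal.tsum_le_tsum fun i => ?_
  rw [sub_apply, ContinuousLinearMap.comp_apply, basisProj_apply_basis]
  split_ifs <;> simp

theorem tendsto_hsSq_sub_comp_basisProj {ι : Type*} (b : HilbertBasis ι ℂ E) {A : E →L[ℂ] E}
    (hA : hsSq A ≠ ⊤) : Tendsto (fun F => hsSq (A - A ∘L basisProj b F)) atTop (𝓝 0) := by
  classical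
  rw [← tsum_enorm_sq_eq_hsSq b] at hA
  refine (ENNReal.tendsto_tsum_compl_atTop_zero hA).congr fun F => ?_
  rw [← tsum_enorm_sq_eq_hsSq b]
  refine (tsum_subtype {i | i ∉ F} fun i => ‖A (b i)‖ₑ ^ 2).trans (tsum_congr fun i => ?_)
  rw [sub_apply, ContinuousLinearMap.comp_apply, basisProj_apply_basis]
  by_cases h : i ∈ F <;> simp [h]

/-- The finite corners of a trace class operator converge to it in trace norm. -/
theorem tendsto_traceNorm_sub_corner {ι : Type*} (b : HilbertBasis ι ℂ E) {Y : E →L[ℂ] E}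
    (hY : IsTraceClass Y) :
    Tendsto (fun F => traceNorm (Y - basisProj b F ∘L Y ∘L basisProj b F)) atTop (𝓝 0) := by
  obtain ⟨A, B, rfl, hA, hB, -, -⟩ := hY.exists_factor_le
  have ha : Tendsto (fun F => √(hsSq (A - A ∘L basisProj b F)).toReal) atTop (𝓝 0) := by
    have := (Real.continuous_sqrt.tendsto _).comp
      ((ENNReal.tendsto_toReal ENNReal.zero_ne_top).comp (tendsto_hsSq_sub_comp_basisProj b hA))
    simpa [Function.comp_def] using this
  have hb : Tendsto (fun F => √(hsSq (B - B ∘L basisProj b F)).toReal) atTop (𝓝 0) := by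
    have := (Real.continuous_sqrt.tendsto _).comp
      ((ENNReal.tendsto_toReal ENNReal.zero_ne_top).comp (tendsto_hsSq_sub_comp_basisProj b hB))
    simpa [Function.comp_def] using this
  have hlim := (ha.mul_const √(hsSq B).toReal).add (hb.const_mul √(hsSq A).toReal)
  rw [zero_mul, mul_zero, add_zero] at hlim
  refine squeeze_zero (fun _ => traceNorm_nonneg _) (fun F => ?_) hlim
  set P := basisProj b F with hP
  have hAP : hsSq (A ∘L P) ≤ hsSq A := hsSq_comp_basisProj_le b A F
  have h1 := isTraceClass_and_traceNorm_factor_le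
    (ne_top_of_le_ne_top hA (hsSq_sub_comp_basisProj_le b A F)) hB
  have h2 := isTraceClass_and_traceNorm_factor_le (ne_top_of_le_ne_top hA hAP)
    (ne_top_of_le_ne_top hB (hsSq_sub_comp_basisProj_le b B F))
  have e : A.adjoint ∘L B - P ∘L (A.adjoint ∘L B) ∘L P
      = (A - A ∘L P).adjoint ∘L B + (A ∘L P).adjoint ∘L (B - B ∘L P) := by
    ext x
    simp [map_sub, ContinuousLinearMap.adjoint_comp, hP, adjoint_basisProj]
  rw [e]
  refine (traceNorm_add_le h1.1 h2.1).trans (add_le_add h1.2 (h2.2.trans ?_))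
  gcongr

variable {H : Type*} [NormedAddCommGroup H] [InnerProductSpace ℂ H] [CompleteSpace H]

/-- A map that is bounded in trace norm is determined by its values on the operators `A ⊗ B`, as
these span all finite corners relative to a product basis. -/
theorem IsIdTensor.unique {Φ : TraceClass H →ₗ[ℂ] TraceClass H}
    {Ψ₁ Ψ₂ : TraceClass (HilbertTensor H) →ₗ[ℂ] TraceClass (HilbertTensor H)}
    (h₁ : IsIdTensor Φ Ψ₁) (h₂ : IsIdTensor Φ Ψ₂) : Ψ₁ = Ψ₂ := by
  obtain ⟨b, hb⟩ := exists_tensor_hilbertBasis H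
  obtain ⟨⟨C₁, hC₁⟩, h₁⟩ := h₁
  obtain ⟨⟨C₂, hC₂⟩, h₂⟩ := h₂
  refine LinearMap.ext fun Y => sub_eq_zero.1 (Subtype.ext ?_)
  let Z : Finset (basisIndex H × basisIndex H) → TraceClass (HilbertTensor H) := fun F =>
    ∑ i ∈ F, ∑ j ∈ F, ⟪b i, (Y : HilbertTensor H →L[ℂ] HilbertTensor H) (b j)⟫_ℂ •
      tctmul (tcRankOne (basis H i.1) (basis H j.1)) (tcRankOne (basis H i.2) (basis H j.2))
  have hZ : ∀ F, (Z F : HilbertTensor H →L[ℂ] HilbertTensor H)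
      = basisProj b F ∘L (Y : HilbertTensor H →L[ℂ] HilbertTensor H) ∘L basisProj b F := by
    intro F
    simp only [basisProj_comp_comp_basisProj, Z, Submodule.coe_sum, Submodule.coe_smul]
    refine Finset.sum_congr rfl fun i _ => Finset.sum_congr rfl fun j _ => ?_
    rw [hb i, hb j, rankOne_vtmul]; rfl
  have hΨ : ∀ F, Ψ₁ (Z F) = Ψ₂ (Z F) := fun F => by
    simp only [Z, map_sum, map_smul, h₁, h₂]
  have hlim := (tendsto_traceNorm_sub_corner b Y.2).const_mul (C₁ + C₂)
  rw [mul_zero] at hlim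
  refine eq_zero_of_traceNorm_le_zero (Subtype.property _)
    (ge_of_tendsto hlim (Eventually.of_forall fun F => ?_))
  have e : Ψ₁ Y - Ψ₂ Y = Ψ₁ (Y - Z F) - Ψ₂ (Y - Z F) := by
    rw [map_sub, map_sub, hΨ]; abel
  rw [e, ← hZ, add_mul, ← Submodule.coe_sub]
  exact (traceNorm_sub_le (Subtype.property _) (Subtype.property _)).trans
    (add_le_add (hC₁ _) (hC₂ _))

end Uniqueness

/-! ### Properties of the ampliation -/

section Ampliation

variable {H : Type*} [NormedAddCommGroup H] [InnerProductSpace ℂ H] [CompleteSpace H]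
  {Φ Ψ : TraceClass H →ₗ[ℂ] TraceClass H}

theorem isIdTensor_idTensor (hΦ : IsCompletelyPositive Φ) (hT : IsTracePreserving Φ) :
    IsIdTensor Φ (idTensor Φ) := by
  have h : ∃ Ψ, IsIdTensor Φ Ψ := (exists_isIdTensor hΦ hT).imp fun _ h => h.1
  rw [idTensor, dif_pos h]
  exact h.choose_spec

theorem isPositiveMap_idTensor (hΦ : IsCompletelyPositive Φ) (hT : IsTracePreserving Φ) :
    IsPositiveMap (idTensor Φ) := by
  obtain ⟨Ψ, h, h', -⟩ := exists_isIdTensor hΦ hT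
  rwa [(isIdTensor_idTensor hΦ hT).unique h]

theorem traceNorm_idTensor_le (hΦ : IsCompletelyPositive Φ) (hT : IsTracePreserving Φ)
    (Y : TraceClass (HilbertTensor H))
    (hY : IsSelfAdjoint (Y : HilbertTensor H →L[ℂ] HilbertTensor H)) :
    traceNorm (idTensor Φ Y : HilbertTensor H →L[ℂ] HilbertTensor H)
      ≤ traceNorm (Y : HilbertTensor H →L[ℂ] HilbertTensor H) := by
  obtain ⟨Ψ, h, -, h'⟩ := exists_isIdTensor hΦ hT
  rw [(isIdTensor_idTensor hΦ hT).unique h]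
  exact traceNorm_map_le_of_isSelfAdjoint h' Y hY

theorem IsIdTensor.comp {Φ' Ψ' : TraceClass (HilbertTensor H) →ₗ[ℂ] TraceClass (HilbertTensor H)}
    (hΦ : IsIdTensor Φ Φ') (hΨ : IsIdTensor Ψ Ψ') : IsIdTensor (Φ ∘ₗ Ψ) (Φ' ∘ₗ Ψ') := by
  obtain ⟨⟨C, hC⟩, h⟩ := hΦ
  obtain ⟨⟨D, hD⟩, h'⟩ := hΨ
  refine ⟨⟨|C| * D, fun Y => (hC _).trans ?_⟩, fun A B => by simp [h, h']⟩
  calc C * traceNorm (Ψ' Y : HilbertTensor H →L[ℂ] HilbertTensor H)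
      ≤ |C| * traceNorm (Ψ' Y : HilbertTensor H →L[ℂ] HilbertTensor H) := by
        gcongr
        · exact traceNorm_nonneg _
        · exact le_abs_self C
    _ ≤ |C| * (D * traceNorm (Y : HilbertTensor H →L[ℂ] HilbertTensor H)) := by
        gcongr
        exact hD Y
    _ = _ := by ring

theorem IsIdTensor.map_blockOp
    {Ψ' : TraceClass (HilbertTensor H) →ₗ[ℂ] TraceClass (HilbertTensor H)}
    (hΨ : IsIdTensor Ψ Ψ') {ι : Type*} [Fintype ι] (u : ι → H) (T : ι → ι → TraceClass H) :
    Ψ' (blockOp u T) = blockOp u fun i j => Ψ (T i j) := by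
  simp [blockOp, map_sum, hΨ.2]

end Ampliation

/-! ### Positivity from contractivity -/

section Contractivity

variable {E : Type*} [NormedAddCommGroup E] [InnerProductSpace ℂ E] [CompleteSpace E]
  {Φ Ψ : TraceClass E →ₗ[ℂ] TraceClass E}

theorem isSelfAdjoint_add_tcAdjoint (Y : TraceClass E) :
    IsSelfAdjoint ((Y + tcAdjoint Y : TraceClass E) : E →L[ℂ] E) := by
  rw [ContinuousLinearMap.isSelfAdjoint_iff']
  simp [add_comm]

theorem isSelfAdjoint_I_smul_sub_tcAdjoint (Y : TraceClass E) :
    IsSelfAdjoint ((Complex.I • (Y - tcAdjoint Y) : TraceClass E) : E →L[ℂ] E) := by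
  rw [ContinuousLinearMap.isSelfAdjoint_iff']
  simp only [Submodule.coe_smul, Submodule.coe_sub, coe_tcAdjoint, map_smulₛₗ, map_sub,
    ContinuousLinearMap.adjoint_adjoint, Complex.conj_I]
  module

/-- If `‖Ψ Y‖₁ ≤ ‖Φ Y‖₁` for Hermitian `Y`, the kernel of `Φ` is contained in that of `Ψ`. -/
theorem map_eq_zero_of_traceNorm_le (hΦ : IsPositiveMap Φ)
    (h : ∀ Y : TraceClass E, IsSelfAdjoint (Y : E →L[ℂ] E) →
      traceNorm (Ψ Y : E →L[ℂ] E) ≤ traceNorm (Φ Y : E →L[ℂ] E))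
    {Y : TraceClass E} (hY : Φ Y = 0) : Ψ Y = 0 := by
  have key : ∀ Z : TraceClass E, IsSelfAdjoint (Z : E →L[ℂ] E) → Φ Z = 0 → Ψ Z = 0 := by
    intro Z hZ hZ0
    refine Subtype.ext (eq_zero_of_traceNorm_le_zero (Ψ Z).2 ((h Z hZ).trans_eq ?_))
    rw [hZ0]
    exact traceNorm_zero
  have hY' : Φ (tcAdjoint Y) = 0 := by
    rw [hΦ.map_tcAdjoint, hY]
    exact Subtype.ext (map_zero _)
  have h1 := key _ (isSelfAdjoint_add_tcAdjoint Y) (by rw [map_add, hY, hY', add_zero])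
  have h2 := key _ (isSelfAdjoint_I_smul_sub_tcAdjoint Y)
    (by rw [map_smul, map_sub, hY, hY', sub_zero, smul_zero])
  rw [map_smul, smul_eq_zero_iff_right Complex.I_ne_zero, map_sub, sub_eq_zero] at h2
  rw [map_add, ← h2, ← two_smul ℂ, smul_eq_zero_iff_right two_ne_zero] at h1
  exact h1

/-- If `‖Ψ Y‖₁ ≤ ‖Φ Y‖₁` for Hermitian `Y`, then `Ψ Y` is positive whenever `Φ Y` is positive
and has the same trace: the trace norm of `Ψ Y` is then at most its trace. -/
theorem isPositive_map_of_traceNorm_le (hΦ : IsPositiveMap Φ) (hΨ : IsPositiveMap Ψ)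
    (h : ∀ Y : TraceClass E, IsSelfAdjoint (Y : E →L[ℂ] E) →
      traceNorm (Ψ Y : E →L[ℂ] E) ≤ traceNorm (Φ Y : E →L[ℂ] E))
    {Y : TraceClass E} (hY : (Φ Y : E →L[ℂ] E).IsPositive)
    (htr : trace (Ψ Y : E →L[ℂ] E) = trace (Φ Y : E →L[ℂ] E)) :
    (Ψ Y : E →L[ℂ] E).IsPositive := by
  have h1 : Φ (tcAdjoint Y) = Φ Y := by
    rw [hΦ.map_tcAdjoint, tcAdjoint_of_isSelfAdjoint hY.isSelfAdjoint]
  have h2 : Ψ (tcAdjoint Y) = Ψ Y := by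
    rw [← sub_eq_zero, ← map_sub]
    exact map_eq_zero_of_traceNorm_le hΦ h (by rw [map_sub, h1, sub_self])
  have half : ∀ Z : TraceClass E, (2⁻¹ : ℂ) • (Z + Z) = Z := fun Z => by module
  have h3 : ∀ Θ : TraceClass E →ₗ[ℂ] TraceClass E, Θ (tcAdjoint Y) = Θ Y →
      Θ ((2⁻¹ : ℂ) • (Y + tcAdjoint Y)) = Θ Y := fun Θ hΘ => by
    rw [map_smul, map_add, hΘ, half]
  have h4 := h ((2⁻¹ : ℂ) • (Y + tcAdjoint Y)) (by
    rw [ContinuousLinearMap.isSelfAdjoint_iff', Submodule.coe_smul, map_smulₛₗ,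
      (isSelfAdjoint_add_tcAdjoint Y).adjoint_eq, map_inv₀, Complex.conj_ofNat])
  rw [h3 Φ h1, h3 Ψ h2] at h4
  have h5 : IsSelfAdjoint (Ψ Y : E →L[ℂ] E) := by
    rw [hΨ.map_tcAdjoint] at h2
    exact ContinuousLinearMap.isSelfAdjoint_iff'.2 (congrArg Subtype.val h2)
  have h6 : traceNorm (Φ Y : E →L[ℂ] E) = (trace (Ψ Y : E →L[ℂ] E)).re := by
    rw [htr, trace_of_isPositive (Φ Y).2 hY, Complex.ofReal_re]
  exact isPositive_of_traceNorm_le_re_trace (Ψ Y) h5 (h4.trans_eq h6)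

theorem exists_factor_of_ker_le (hs : Function.Surjective Φ)
    (hker : ∀ Y, Φ Y = 0 → Ψ Y = 0) : ∃ Θ : TraceClass E →ₗ[ℂ] TraceClass E, Ψ = Θ ∘ₗ Φ := by
  obtain ⟨g, hg⟩ := Φ.exists_rightInverse_of_surjective (LinearMap.range_eq_top.2 hs)
  refine ⟨Ψ ∘ₗ g, LinearMap.ext fun Y => ?_⟩
  have h := hker (Y - g (Φ Y)) (by
    rw [map_sub, ← LinearMap.comp_apply Φ g, hg, LinearMap.id_apply, sub_self])
  rw [map_sub, sub_eq_zero] at h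
  exact h

theorem isTracePreserving_of_comp {Θ : TraceClass E →ₗ[ℂ] TraceClass E}
    (hs : Function.Surjective Φ) (hΦ : IsTracePreserving Φ) (h : IsTracePreserving (Θ ∘ₗ Φ)) :
    IsTracePreserving Θ := by
  intro X
  obtain ⟨Y, rfl⟩ := hs X
  rw [hΦ Y, ← h Y]; rfl

end Contractivity

/-! ### Complete positivity from the ampliation by the same space -/

section CompletePositivity

variable {H : Type*} [NormedAddCommGroup H] [InnerProductSpace ℂ H] [CompleteSpace H]

theorem sum_inner_sum_smul {ι κ : Type*} [Fintype ι] [Fintype κ] (T : ι → ι → TraceClass H)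
    (c : ι → κ → ℂ) (y : κ → H) :
    ∑ i, ∑ j, ⟪∑ k, c i k • y k, (T i j : H →L[ℂ] H) (∑ l, c j l • y l)⟫_ℂ
      = ∑ k, ∑ l, ⟪y k, ((∑ i, ∑ j, (starRingEnd ℂ (c i k) * c j l) • T i j : TraceClass H) :
          H →L[ℂ] H) (y l)⟫_ℂ := by
  simp only [map_sum, map_smul, sum_inner, inner_sum, inner_smul_left, inner_smul_right,
    Submodule.coe_sum, Submodule.coe_smul, sum_apply, smul_apply]
  simp only [Finset.mul_sum, ← Finset.sum_product']
  refine Finset.sum_nbij' (fun p => (p.2.2.2, p.2.2.1, p.1, p.2.1))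
    (fun q => (q.2.2.1, q.2.2.2, q.2.1, q.1)) ?_ ?_ ?_ ?_ fun p _ => ?_
  · simp
  · simp
  · simp
  · simp
  · ring

/-- A map is completely positive if its block matrices are positive on vectors with orthonormal
entries. The entries of an arbitrary vector lie in the span of an orthonormal family, whose size is
at most the dimension of `H`; so the ampliation by `H` itself suffices for complete positivity, even
if `H` is finite dimensional. -/
theorem isCompletelyPositive_of_orthonormal {Φ : TraceClass H →ₗ[ℂ] TraceClass H}
    (h : ∀ (m : ℕ) (e : Fin m → H), Orthonormal ℂ e → ∀ S : Fin m → Fin m → TraceClass H,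
      IsPositiveBlock S → 0 ≤ ∑ k, ∑ l, ⟪e k, (Φ (S k l) : H →L[ℂ] H) (e l)⟫_ℂ) :
    IsCompletelyPositive Φ := by
  intro n T hT x
  have := FiniteDimensional.span_of_finite ℂ (Set.finite_range x)
  let b := stdOrthonormalBasis ℂ (Submodule.span ℂ (Set.range x))
  let e : Fin _ → H := fun k => (b k : H)
  have he : Orthonormal ℂ e :=
    b.orthonormal.comp_linearIsometry (Submodule.span ℂ (Set.range x)).subtypeₗᵢ
  let x' : Fin n → Submodule.span ℂ (Set.range x) := fun i =>
    ⟨x i, Submodule.subset_span ⟨i, rfl⟩⟩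
  have hx : ∀ i, ∑ k, b.repr (x' i) k • e k = x i := fun i => by
    have := congrArg Subtype.val (b.sum_repr (x' i))
    simpa only [Submodule.coe_sum, Submodule.coe_smul] using this
  have h1 := h _ e he (fun k l => ∑ i, ∑ j,
    (starRingEnd ℂ (b.repr (x' i) k) * b.repr (x' j) l) • T i j) fun y => by
      rw [← sum_inner_sum_smul T fun i k => b.repr (x' i) k]
      exact hT _
  simp only [map_sum, map_smul] at h1
  rw [← sum_inner_sum_smul (fun i j => Φ (T i j)) fun i k => b.repr (x' i) k] at h1
  simpa only [hx] using h1

theorem inner_sum_vtmul_blockOp {ι : Type*} [Fintype ι] {e : ι → H} (he : Orthonormal ℂ e)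
    (T : ι → ι → TraceClass H) :
    ⟪∑ k, vtmul (e k) (e k),
      (blockOp e T : HilbertTensor H →L[ℂ] HilbertTensor H) (∑ k, vtmul (e k) (e k))⟫_ℂ
      = ∑ k, ∑ l, ⟪e k, (T k l : H →L[ℂ] H) (e l)⟫_ℂ := by
  classical
  have h : ∀ k, (vtmulL (e k)).adjoint (∑ l, vtmul (e l) (e l)) = e k := fun k => by
    simp [map_sum, vtmulL_adjoint_vtmul, orthonormal_iff_ite.1 he]
  simp only [inner_blockOp, h]

variable {Φ Ψ Θ : TraceClass H →ₗ[ℂ] TraceClass H}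

/-- If, on Hermitian operators, the ampliation of `Ψ = Θ ∘ Φ` is dominated in trace norm by that of
the surjective map `Φ`, then `Θ` is completely positive: for a positive block matrix `S` and an
orthonormal family `e`, the operator `∑ |eₖ⟩⟨eₗ| ⊗ Θ(Sₖₗ)` is positive, and
`inner_sum_vtmul_blockOp` evaluates it at `∑ eₖ ⊗ eₖ`. -/
theorem isCompletelyPositive_of_idTensor (hΦ : IsCompletelyPositive Φ)
    (hΦ' : IsTracePreserving Φ) (hΨ : IsCompletelyPositive Ψ) (hΨ' : IsTracePreserving Ψ)
    (hs : Function.Surjective Φ)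
    (h : ∀ Y : TraceClass (HilbertTensor H),
      IsSelfAdjoint (Y : HilbertTensor H →L[ℂ] HilbertTensor H) →
      traceNorm (idTensor Ψ Y : HilbertTensor H →L[ℂ] HilbertTensor H)
        ≤ traceNorm (idTensor Φ Y : HilbertTensor H →L[ℂ] HilbertTensor H))
    (hΘ : Ψ = Θ ∘ₗ Φ) : IsCompletelyPositive Θ := by
  refine isCompletelyPositive_of_orthonormal fun m e he S hS => ?_
  choose R hR using fun k l => hs (S k l)
  have h1 : idTensor Φ (blockOp e R) = blockOp e S := by
    rw [(isIdTensor_idTensor hΦ hΦ').map_blockOp]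
    simp only [hR]
  have h2 : idTensor Ψ (blockOp e R) = blockOp e fun k l => Θ (S k l) := by
    rw [(isIdTensor_idTensor hΨ hΨ').map_blockOp, hΘ]
    simp only [LinearMap.comp_apply, hR]
  have hpos := isPositive_map_of_traceNorm_le (Y := blockOp e R)
    (isPositiveMap_idTensor hΦ hΦ') (isPositiveMap_idTensor hΨ hΨ') h
    (by rw [h1]; exact blockOp_isPositive e hS) (by
      rw [h1, h2, trace_blockOp he, trace_blockOp he]
      exact Finset.sum_congr rfl fun k _ =>
        isTracePreserving_of_comp hs hΦ' (hΘ ▸ hΨ') (S k k))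
  rw [h2] at hpos
  rw [← inner_sum_vtmul_blockOp he]
  exact hpos.inner_nonneg_right _

/-- If, on Hermitian operators, the ampliation of `Ψ` is dominated in trace norm by that of `Φ`,
then the kernel of `Φ` is contained in that of `Ψ`. -/
theorem map_eq_zero_of_idTensor (hΦ : IsCompletelyPositive Φ)
    (hΦ' : IsTracePreserving Φ) (hΨ : IsCompletelyPositive Ψ) (hΨ' : IsTracePreserving Ψ)
    (h : ∀ Y : TraceClass (HilbertTensor H),
      IsSelfAdjoint (Y : HilbertTensor H →L[ℂ] HilbertTensor H) →
      traceNorm (idTensor Ψ Y : HilbertTensor H →L[ℂ] HilbertTensor H)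
        ≤ traceNorm (idTensor Φ Y : HilbertTensor H →L[ℂ] HilbertTensor H))
    {X : TraceClass H} (hX : Φ X = 0) : Ψ X = 0 := by
  refine Subtype.ext (ContinuousLinearMap.ext fun u => ?_)
  rcases eq_or_ne u 0 with rfl | hu
  · simp
  -- the ampliations are tested on `|u⟩⟨u| ⊗ X`
  have h1 : idTensor Ψ (tctmul (tcRankOne u u) X) = 0 := by
    refine map_eq_zero_of_traceNorm_le (isPositiveMap_idTensor hΦ hΦ') h ?_
    rw [(isIdTensor_idTensor hΦ hΦ').2, hX, ← tctmulL_apply, map_zero]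
  rw [(isIdTensor_idTensor hΨ hΨ').2] at h1
  have h2 := congrArg (compress (vtmulL u) (vtmulL u)) h1
  rw [compress_vtmulL_tctmul, map_zero, smul_eq_zero_iff_right (by simp [hu])] at h2
  rw [h2]

end CompletePositivity

/-! ### Monotonicity in time -/

section Time

theorem nonpos_of_antitoneOn_Ici {f : ℝ → ℝ} (hf : AntitoneOn f (Set.Ici 0)) {t d : ℝ}
    (ht : 0 ≤ t) (hd : HasDerivWithinAt f d (Set.Ici 0) t) : d ≤ 0 := by
  have h : HasDerivWithinAt f d (Set.Ici t) t := hd.mono (Set.Ici_subset_Ici.2 ht)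
  have := (uniqueDiffOn_Ici t t Set.self_mem_Ici).accPt
  exact h.nonpos_of_antitoneOn this (hf.mono (Set.Ici_subset_Ici.2 ht))

theorem antitoneOn_Ici_of_hasDerivWithinAt {f : ℝ → ℝ}
    (h : ∀ t : ℝ, 0 ≤ t → ∃ d : ℝ, d ≤ 0 ∧ HasDerivWithinAt f d (Set.Ici 0) t) :
    AntitoneOn f (Set.Ici 0) := by
  choose! f' hf' hf using h
  refine antitoneOn_of_hasDerivWithinAt_nonpos (f' := f') (convex_Ici 0)
    (fun t ht => (hf t ht).continuousWithinAt) (fun t ht => ?_) fun t ht => ?_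
  · exact (hf t (interior_subset ht)).mono interior_subset
  · exact hf' t (interior_subset ht)

end Time

section Divisibility

variable {H : Type*} [NormedAddCommGroup H] [InnerProductSpace ℂ H] [CompleteSpace H]
  {Λ : ℝ → TraceClass H →ₗ[ℂ] TraceClass H}

theorem antitoneOn_normAlong_of_isPDivisible (hΛ : IsDynamicalMap Λ) (h : IsPDivisible Λ)
    (X : TraceClass H) (hX : IsSelfAdjoint (X : H →L[ℂ] H)) :
    AntitoneOn (normAlong Λ X) (Set.Ici 0) := by
  intro s hs t _ hst
  obtain ⟨Φ, hΦ, hΦ', hst⟩ := h s t hs hst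
  have hX' : IsSelfAdjoint (Λ s X : H →L[ℂ] H) := by
    rw [ContinuousLinearMap.isSelfAdjoint_iff', ← coe_tcAdjoint,
      ← (hΛ s hs).1.isPositiveMap.map_tcAdjoint, tcAdjoint_of_isSelfAdjoint hX]
  rw [normAlong, normAlong, hst]
  exact traceNorm_map_le_of_isSelfAdjoint
    (fun P hP => (traceNorm_map_of_isPositive hΦ hΦ' P hP).le) (Λ s X) hX'

theorem antitoneOn_normAlong_of_isCPDivisible (hΛ : IsDynamicalMap Λ) (h : IsCPDivisible Λ)
    (Y : TraceClass (HilbertTensor H))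
    (hY : IsSelfAdjoint (Y : HilbertTensor H →L[ℂ] HilbertTensor H)) :
    AntitoneOn (normAlong (fun t => idTensor (Λ t)) Y) (Set.Ici 0) := by
  intro s hs t ht hst
  obtain ⟨Φ, hΦ, hΦ', hst⟩ := h s t hs hst
  have hY' : IsSelfAdjoint
      (idTensor (Λ s) Y : HilbertTensor H →L[ℂ] HilbertTensor H) := by
    rw [ContinuousLinearMap.isSelfAdjoint_iff', ← coe_tcAdjoint,
      ← (isPositiveMap_idTensor (hΛ s hs).1 (hΛ s hs).2).map_tcAdjoint,
      tcAdjoint_of_isSelfAdjoint hY]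
  have hcomp : idTensor (Λ t) = idTensor Φ ∘ₗ idTensor (Λ s) := by
    refine (isIdTensor_idTensor (hΛ t ht).1 (hΛ t ht).2).unique ?_
    rw [hst]
    exact (isIdTensor_idTensor hΦ hΦ').comp (isIdTensor_idTensor (hΛ s hs).1 (hΛ s hs).2)
  rw [normAlong, normAlong, hcomp]
  exact traceNorm_idTensor_le hΦ hΦ' _ hY'

theorem isPDivisible_of_antitoneOn (hΛ : IsDynamicalMap Λ)
    (hs : ∀ t, 0 ≤ t → Function.Surjective (Λ t))
    (h : ∀ X : TraceClass H, IsSelfAdjoint (X : H →L[ℂ] H) →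
      AntitoneOn (normAlong Λ X) (Set.Ici 0)) : IsPDivisible Λ := by
  intro s t hs0 hst
  have ht0 := hs0.trans hst
  have hle := fun X hX => h X hX hs0 ht0 hst
  have hp := (hΛ s hs0).1.isPositiveMap
  obtain ⟨Φ, hΦ⟩ := exists_factor_of_ker_le (hs s hs0) fun Y =>
    map_eq_zero_of_traceNorm_le hp hle
  have htr : IsTracePreserving Φ :=
    isTracePreserving_of_comp (hs s hs0) (hΛ s hs0).2 (hΦ ▸ (hΛ t ht0).2)
  refine ⟨Φ, fun X hX => ?_, htr, hΦ⟩
  obtain ⟨Y, rfl⟩ := hs s hs0 X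
  have := isPositive_map_of_traceNorm_le hp (hΛ t ht0).1.isPositiveMap hle hX
    (by rw [(hΛ s hs0).2, (hΛ t ht0).2])
  rwa [hΦ] at this

theorem isCPDivisible_of_antitoneOn (hΛ : IsDynamicalMap Λ)
    (hs : ∀ t, 0 ≤ t → Function.Surjective (Λ t))
    (h : ∀ Y : TraceClass (HilbertTensor H),
      IsSelfAdjoint (Y : HilbertTensor H →L[ℂ] HilbertTensor H) →
      AntitoneOn (normAlong (fun t => idTensor (Λ t)) Y) (Set.Ici 0)) : IsCPDivisible Λ := by
  intro s t hs0 hst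
  have ht0 := hs0.trans hst
  have hle := fun Y hY => h Y hY hs0 ht0 hst
  obtain ⟨hs1, hs2⟩ := hΛ s hs0
  obtain ⟨ht1, ht2⟩ := hΛ t ht0
  obtain ⟨Φ, hΦ⟩ := exists_factor_of_ker_le (hs s hs0) fun X =>
    map_eq_zero_of_idTensor hs1 hs2 ht1 ht2 hle
  exact ⟨Φ, isCompletelyPositive_of_idTensor hs1 hs2 ht1 ht2 (hs s hs0) hle hΦ,
    isTracePreserving_of_comp (hs s hs0) hs2 (hΦ ▸ ht2), hΦ⟩

end Divisibility

end QuantumDynamics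

theorem mainTheorem1
    {H : Type*} [NormedAddCommGroup H] [InnerProductSpace ℂ H] [CompleteSpace H]
    [TopologicalSpace.SeparableSpace H]
    (Λ : ℝ → QuantumDynamics.TraceClass H →ₗ[ℂ] QuantumDynamics.TraceClass H)
    (hΛ : QuantumDynamics.IsDynamicalMap Λ) :
    -- P-divisibility
    (QuantumDynamics.IsPDivisible Λ →
      ∀ X : QuantumDynamics.TraceClass H, IsSelfAdjoint (X : H →L[ℂ] H) →
        AntitoneOn (QuantumDynamics.normAlong Λ X) (Set.Ici 0) ∧
        ∀ t d : ℝ, 0 ≤ t →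
          HasDerivWithinAt (QuantumDynamics.normAlong Λ X) d (Set.Ici 0) t → d ≤ 0) ∧
    -- the maps `I ⊗ Λ_t` are well defined
    (∀ t, 0 ≤ t →
      QuantumDynamics.IsIdTensor (Λ t) (QuantumDynamics.idTensor (Λ t)) ∧
      ∀ Ψ, QuantumDynamics.IsIdTensor (Λ t) Ψ → Ψ = QuantumDynamics.idTensor (Λ t)) ∧
    -- CP-divisibility
    (QuantumDynamics.IsCPDivisible Λ →
      ∀ Y : QuantumDynamics.TraceClass (QuantumDynamics.HilbertTensor H),
        IsSelfAdjoint
          (Y : QuantumDynamics.HilbertTensor H →L[ℂ] QuantumDynamics.HilbertTensor H) →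
        AntitoneOn (QuantumDynamics.normAlong (fun t => QuantumDynamics.idTensor (Λ t)) Y)
          (Set.Ici 0) ∧
        ∀ t d : ℝ, 0 ≤ t →
          HasDerivWithinAt
            (QuantumDynamics.normAlong (fun t => QuantumDynamics.idTensor (Λ t)) Y) d
            (Set.Ici 0) t → d ≤ 0) ∧
    -- the converses for surjective `Λ_t`
    ((∀ t, 0 ≤ t → Function.Surjective (Λ t)) →
      ((∀ X : QuantumDynamics.TraceClass H, IsSelfAdjoint (X : H →L[ℂ] H) →
          AntitoneOn (QuantumDynamics.normAlong Λ X) (Set.Ici 0)) →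
        QuantumDynamics.IsPDivisible Λ) ∧
      ((∀ X : QuantumDynamics.TraceClass H, IsSelfAdjoint (X : H →L[ℂ] H) →
          ∀ t : ℝ, 0 ≤ t → ∃ d : ℝ, d ≤ 0 ∧
            HasDerivWithinAt (QuantumDynamics.normAlong Λ X) d (Set.Ici 0) t) →
        QuantumDynamics.IsPDivisible Λ) ∧
      ((∀ Y : QuantumDynamics.TraceClass (QuantumDynamics.HilbertTensor H),
          IsSelfAdjoint
            (Y : QuantumDynamics.HilbertTensor H →L[ℂ] QuantumDynamics.HilbertTensor H) →
          AntitoneOn (QuantumDynamics.normAlong (fun t => QuantumDynamics.idTensor (Λ t)) Y)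
            (Set.Ici 0)) →
        QuantumDynamics.IsCPDivisible Λ) ∧
      ((∀ Y : QuantumDynamics.TraceClass (QuantumDynamics.HilbertTensor H),
          IsSelfAdjoint
            (Y : QuantumDynamics.HilbertTensor H →L[ℂ] QuantumDynamics.HilbertTensor H) →
          ∀ t : ℝ, 0 ≤ t → ∃ d : ℝ, d ≤ 0 ∧
            HasDerivWithinAt
              (QuantumDynamics.normAlong (fun t => QuantumDynamics.idTensor (Λ t)) Y) d
              (Set.Ici 0) t) →
        QuantumDynamics.IsCPDivisible Λ)) := by
  have hderiv {f : ℝ → ℝ} (hf : AntitoneOn f (Set.Ici 0)) :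
      ∀ t d : ℝ, 0 ≤ t → HasDerivWithinAt f d (Set.Ici 0) t → d ≤ 0 :=
    fun _ _ => QuantumDynamics.nonpos_of_antitoneOn_Ici hf
  refine ⟨fun h X hX => ?_, fun t ht => ?_, fun h Y hY => ?_, fun hs => ⟨?_, ?_, ?_, ?_⟩⟩
  · have hmono := QuantumDynamics.antitoneOn_normAlong_of_isPDivisible hΛ h X hX
    exact ⟨hmono, hderiv hmono⟩
  · have h := QuantumDynamics.isIdTensor_idTensor (hΛ t ht).1 (hΛ t ht).2
    exact ⟨h, fun Ψ hΨ => hΨ.unique h⟩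
  · have hmono := QuantumDynamics.antitoneOn_normAlong_of_isCPDivisible hΛ h Y hY
    exact ⟨hmono, hderiv hmono⟩
  · exact QuantumDynamics.isPDivisible_of_antitoneOn hΛ hs
  · exact fun h => QuantumDynamics.isPDivisible_of_antitoneOn hΛ hs fun X hX =>
      QuantumDynamics.antitoneOn_Ici_of_hasDerivWithinAt (h X hX)
  · exact QuantumDynamics.isCPDivisible_of_antitoneOn hΛ hs
  · exact fun h => QuantumDynamics.isCPDivisible_of_antitoneOn hΛ hs fun Y hY =>
      QuantumDynamics.antitoneOn_Ici_of_hasDerivWithinAt (h Y hY)
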